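/- **Setting.** There are $n$ bidders and a matroid $M$ on the ground set $\{1,\dots,n\}$; the sets of bidders that can be served simultaneously are the independent sets of $M$. Bidder $i$ has a private value $v_i\ge 0$ drawn, independently of the others, from a distribution $F_i$ with expectation $\mu_i>0$ and standard deviation at most $\sigma_i$ (in particular, exactly $\sigma_i$ is allowed). Each $F_i$ is regular: it has a density $f_i$, positive exactly on an interval $D_i\subseteq[0,\infty)$, and $x-\frac{1-F_i(x)}{f_i(x)}$ is nondecreasing on $D_i$. A (randomized, direct) mechanism maps each bid vector to a vector of winning probabilities in the convex hull of the indicator vectors of independent sets, and to a vector of expected payments. It is admissible if it is Bayesian incentive compatible and interim individually rational (for all types in $[0,\infty)$, with integrable payments). The optimal revenue $\mathrm{OPT}$ and the optimal welfare $\mathrm{VAL}$ are the suprema, over all admissible mechanisms, of the expected total payment and of the expected value $\sum_i x_i(v)v_i$. For $r\ge 0$ let $\rho(r)$ be the unique positive solution $\rho$ of $\frac{1}{\rho^2}\left(2e^{\rho-1}-1\right)=r^2+1$. For $\mu>0,\sigma\ge0$ let $0<\pi_1\le\pi_2$ be the unique solution of $\pi_1\left(1+\ln\frac{\pi_2}{\pi_1}\right)=\mu$,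 $\pi_1(2\pi_2-\pi_1)=\mu^2+\sigma^2$. The *log-lottery* $P^{\log}_{\mu,\sigma}$ is the random price supported on $[\pi_1,\pi_2]$ with cdf $$x\mapsto\frac{\pi_2\ln\frac{x}{\pi_1}-(x-\pi_1)}{\pi_2\ln\frac{\pi_2}{\pi_1}-(\pi_2-\pi_1)}\qquad(\pi_1\le x\le \pi_2)$$ (the point mass at $\mu$ if $\sigma=0$). *Lazy-VCG* with reserves $p_1,\dots,p_n$ selects an independent set $W$ maximizing $\sum_{i\in W}v_i$ (ties broken arbitrarily), and offers each $i\in W$ the take-it-or-leave-it price $\max\{t_i,p_i\}$, where $t_i=\max_{S\text{ indep.},\,i\notin S}\sum_{j\in S}v_j-\sum_{j\in W\setminus\{i\}}v_j$ is the VCG payment of $i$. Bidder $i$ wins and pays this price if $i\in W$ and the price is at most $v_i$; all others lose and pay nothing. **Statement.** Let the reserves be drawn independently of each other and of the values, $p_i\sim P^{\log}_{\mu_i,\sigma_i}$, and let $r=\max_i\frac{\sigma_i}{\mu_i}$. Then the expected revenue $\mathrm{REV}$ and the expected welfare $\mathrm{WEL}$ (total value of the winners) of Lazy-VCG satisfy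 $$\mathrm{OPT}\le 2\rho(r)\cdot \mathrm{REV}\qquad\text{and}\qquad \mathrm{VAL}\le\rho(r)\cdot\mathrm{WEL}.$$ -/

import Mathlib

open MeasureTheory ProbabilityTheory

noncomputable section

namespace LazyVCG

/-! ### The function `ρ` -/

/-- `x` is a positive solution of `(2 e^(x - 1) - 1) / x² = r² + 1`. -/
def IsRho (r x : ℝ) : Prop :=
  0 < x ∧ 1 / x ^ 2 * (2 * Real.exp (x - 1) - 1) = r ^ 2 + 1

lemma hasDerivAt_rhoAux {x : ℝ} (hx : 0 < x) :
    HasDerivAt (fun x : ℝ => 1 / x ^ 2 * (2 * Real.exp (x - 1) - 1))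
      (2 * (Real.exp (x - 1) * (x - 2) + 1) / x ^ 3) x := by
  have h1 : HasDerivAt (fun x : ℝ => 2 * Real.exp (x - 1) - 1) (2 * Real.exp (x - 1)) x := by
    have := (((hasDerivAt_id x).sub_const 1).exp.const_mul 2).sub_const 1
    simpa using this
  have h2 : HasDerivAt (fun x : ℝ => x ^ 2) (2 * x) x := by
    simpa using hasDerivAt_pow 2 x
  have h3 := h1.div h2 (by positivity)
  have h4 : (fun x : ℝ => 1 / x ^ 2 * (2 * Real.exp (x - 1) - 1))
      = (fun x : ℝ => 2 * Real.exp (x - 1) - 1) / (fun x : ℝ => x ^ 2) := by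
    funext y
    simp only [Pi.div_apply]
    ring
  rw [h4]
  refine h3.congr_deriv ?_
  field_simp
  ring

lemma strictMonoOn_rhoAux :
    StrictMonoOn (fun x : ℝ => 1 / x ^ 2 * (2 * Real.exp (x - 1) - 1)) (Set.Ioi 0) := by
  have hpos : ∀ x : ℝ, 0 < x → x ≠ 1 →
      0 < deriv (fun x : ℝ => 1 / x ^ 2 * (2 * Real.exp (x - 1) - 1)) x := by
    intro x hx hx1
    rw [(hasDerivAt_rhoAux hx).deriv]
    have h := Real.add_one_lt_exp (x := 1 - x) (by intro h; apply hx1; linarith)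
    have he : Real.exp (x - 1) * Real.exp (1 - x) = 1 := by
      rw [← Real.exp_add]; simp
    have := mul_lt_mul_of_pos_left h (Real.exp_pos (x - 1))
    have : 0 < Real.exp (x - 1) * (x - 2) + 1 := by nlinarith
    positivity
  have hc : ContinuousOn (fun x : ℝ => 1 / x ^ 2 * (2 * Real.exp (x - 1) - 1)) (Set.Ioi 0) :=
    fun x hx => (hasDerivAt_rhoAux hx).continuousAt.continuousWithinAt
  have hA : StrictMonoOn (fun x : ℝ => 1 / x ^ 2 * (2 * Real.exp (x - 1) - 1)) (Set.Ioc 0 1) := by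
    refine strictMonoOn_of_deriv_pos (convex_Ioc 0 1) (hc.mono fun x hx => hx.1) ?_
    intro x hx
    rw [interior_Ioc] at hx
    exact hpos x hx.1 hx.2.ne
  have hB : StrictMonoOn (fun x : ℝ => 1 / x ^ 2 * (2 * Real.exp (x - 1) - 1)) (Set.Ici 1) := by
    refine strictMonoOn_of_deriv_pos (convex_Ici 1)
      (hc.mono fun x hx => Set.mem_Ioi.2 (lt_of_lt_of_le zero_lt_one (Set.mem_Ici.1 hx))) ?_
    intro x hx
    rw [interior_Ici] at hx
    exact hpos x (zero_lt_one.trans hx) (ne_of_gt hx)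
  have := hA.union hB (c := 1) ⟨⟨zero_lt_one, le_rfl⟩, fun x hx => hx.2⟩
    ⟨Set.mem_Ici.2 le_rfl, fun x hx => hx⟩
  rwa [Set.Ioc_union_Ici_eq_Ioi zero_lt_one] at this

lemma existsUnique_isRho (r : ℝ) : ∃! x : ℝ, IsRho r x := by
  have hlim : Filter.Tendsto (fun x : ℝ => Real.exp x / x ^ 2) Filter.atTop Filter.atTop :=
    Real.tendsto_exp_div_pow_atTop 2
  obtain ⟨b, hb, hb1⟩ := ((hlim.eventually_ge_atTop ((r ^ 2 + 2) * Real.exp 1)).and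
    (Filter.eventually_ge_atTop (1 : ℝ))).exists
  have hb0 : 0 < b := by linarith
  have hbig : r ^ 2 + 1 ≤ 1 / b ^ 2 * (2 * Real.exp (b - 1) - 1) := by
    have h1 : r ^ 2 + 2 ≤ Real.exp (b - 1) / b ^ 2 := by
      rw [Real.exp_sub, div_right_comm]
      rwa [le_div_iff₀ (Real.exp_pos 1)]
    have h2 : 1 / b ^ 2 ≤ 1 := by
      rw [div_le_one (by positivity)]
      nlinarith
    have h3 : 1 / b ^ 2 * (2 * Real.exp (b - 1) - 1)
        = 2 * (Real.exp (b - 1) / b ^ 2) - 1 / b ^ 2 := by ring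
    rw [h3]
    nlinarith [sq_nonneg r]
  have hc : ContinuousOn (fun x : ℝ => 1 / x ^ 2 * (2 * Real.exp (x - 1) - 1)) (Set.Icc 1 b) :=
    fun x hx => (hasDerivAt_rhoAux
      (lt_of_lt_of_le zero_lt_one hx.1)).continuousAt.continuousWithinAt
  have hmem : r ^ 2 + 1 ∈ Set.Icc ((fun x : ℝ => 1 / x ^ 2 * (2 * Real.exp (x - 1) - 1)) 1)
      ((fun x : ℝ => 1 / x ^ 2 * (2 * Real.exp (x - 1) - 1)) b) := by
    refine ⟨?_, hbig⟩
    norm_num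
    nlinarith [sq_nonneg r]
  obtain ⟨x, hx, hxe⟩ := intermediate_value_Icc hb1 hc hmem
  have hx0 : 0 < x := lt_of_lt_of_le zero_lt_one hx.1
  refine ⟨x, ⟨hx0, hxe⟩, ?_⟩
  rintro y ⟨hy0, hye⟩
  exact strictMonoOn_rhoAux.injOn hy0 hx0 (hye.trans hxe.symm)

/-- `ρ(r)`: the unique positive solution of `(2 e^(ρ - 1) - 1) / ρ² = r² + 1`. -/
def rho (r : ℝ) : ℝ := Classical.choose (existsUnique_isRho r).exists

lemma isRho_rho (r : ℝ) : IsRho r (rho r) := Classical.choose_spec (existsUnique_isRho r).exists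

lemma one_le_rho (r : ℝ) : 1 ≤ rho r := by
  obtain ⟨h0, he⟩ := isRho_rho r
  by_contra! h
  have := strictMonoOn_rhoAux (a := rho r) (b := 1) h0 (Set.mem_Ioi.2 zero_lt_one) h
  simp only [he] at this
  norm_num at this
  nlinarith [sq_nonneg r]

/-! ### The log-lottery -/

/-- The end points `0 < p.1 ≤ p.2` of the support of the log-lottery solve this system. -/
def IsLogParams (μ σ : ℝ) (p : ℝ × ℝ) : Prop :=
  0 < p.1 ∧ p.1 ≤ p.2 ∧ p.1 * (1 + Real.log (p.2 / p.1)) = μ ∧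
    p.1 * (2 * p.2 - p.1) = μ ^ 2 + σ ^ 2

lemma existsUnique_isLogParams {μ : ℝ} (hμ : 0 < μ) (σ : ℝ) :
    ∃! p : ℝ × ℝ, IsLogParams μ σ p := by
  obtain ⟨h0, he⟩ := isRho_rho (σ / μ)
  have h1 := one_le_rho (σ / μ)
  set s := rho (σ / μ) with hs
  refine ⟨(μ / s, μ / s * Real.exp (s - 1)), ⟨by positivity, ?_, ?_, ?_⟩, ?_⟩
  · exact le_mul_of_one_le_right (by positivity) (Real.one_le_exp (by linarith))
  · have : μ / s * Real.exp (s - 1) / (μ / s) = Real.exp (s - 1) := by field_simp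
    simp only [this, Real.log_exp]
    field_simp
    ring
  · have : μ / s * (2 * (μ / s * Real.exp (s - 1)) - μ / s)
        = μ ^ 2 * (1 / s ^ 2 * (2 * Real.exp (s - 1) - 1)) := by
      field_simp
    simp only [this, he]
    field_simp
    ring
  · rintro ⟨a, b⟩ ⟨ha, hab, h2, h3⟩
    simp only at ha hab h2 h3
    have hb : 0 < b := ha.trans_le hab
    have hl : Real.log (b / a) = μ / a - 1 := by
      field_simp
      linarith
    have hbe : b = a * Real.exp (μ / a - 1) := by
      rw [← hl, Real.exp_log (by positivity)]
      field_simp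
    have hrho : IsRho (σ / μ) (μ / a) := by
      refine ⟨by positivity, ?_⟩
      have : a * (2 * b - a) = a ^ 2 * (2 * Real.exp (μ / a - 1) - 1) := by
        conv_lhs => rw [hbe]
        ring
      rw [h3] at this
      have e : 1 / (μ / a) ^ 2 * (2 * Real.exp (μ / a - 1) - 1)
          = a ^ 2 * (2 * Real.exp (μ / a - 1) - 1) / μ ^ 2 := by
        generalize Real.exp (μ / a - 1) = E
        field_simp
      rw [e, ← this]
      field_simp
      ring
    have hsa : μ / a = s := (existsUnique_isRho (σ / μ)).unique hrho (isRho_rho _)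
    have hae : a = μ / s := by
      rw [← hsa]
      field_simp
    rw [hsa] at hbe
    rw [hbe, hae]

open Classical in
/-- The unique solution `(π₁, π₂)` of the system (for `0 < μ`). -/
def logParams (μ σ : ℝ) : ℝ × ℝ :=
  if h : 0 < μ then Classical.choose (existsUnique_isLogParams h σ).exists else (1, 1)

lemma isLogParams_logParams {μ : ℝ} (hμ : 0 < μ) (σ : ℝ) :
    IsLogParams μ σ (logParams μ σ) := by
  rw [logParams, dif_pos hμ]
  exact Classical.choose_spec (existsUnique_isLogParams hμ σ).exists

/-- `π₂ ln (x / π₁) - (x - π₁)`: the numerator of the cdf of the log-lottery. -/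
def logNum (π₁ π₂ x : ℝ) : ℝ := π₂ * Real.log (x / π₁) - (x - π₁)

/-- The density on `[π₁, π₂]` of the log-lottery, i.e. the derivative of its cdf. -/
def logDensity (π₁ π₂ x : ℝ) : ℝ := (π₂ / x - 1) / logNum π₁ π₂ π₂

open Classical in
/-- The log-lottery `P^log_{μ,σ}`, as a law on prices. For `σ = 0` (where `π₁ = π₂ = μ`) it is the
point mass at `μ`. -/
def logLottery (μ σ : ℝ) : Measure ℝ :=
  if 0 < μ ∧ 0 < σ then
    (volume.restrict (Set.Icc (logParams μ σ).1 (logParams μ σ).2)).withDensity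
      fun x => ENNReal.ofReal (logDensity (logParams μ σ).1 (logParams μ σ).2 x)
  else Measure.dirac μ

lemma logParams_lt {μ σ : ℝ} (hμ : 0 < μ) (hσ : 0 < σ) :
    (logParams μ σ).1 < (logParams μ σ).2 := by
  obtain ⟨h0, hle, h1, h2⟩ := isLogParams_logParams hμ σ
  refine lt_of_le_of_ne hle fun h => ?_
  rw [← h] at h1 h2
  rw [div_self h0.ne', Real.log_one] at h1
  have : (logParams μ σ).1 = μ := by linarith
  rw [this] at h2
  nlinarith

lemma logNum_pos {a b : ℝ} (ha : 0 < a) (hab : a < b) : 0 < logNum a b b := by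
  have hb := ha.trans hab
  have h := Real.log_lt_sub_one_of_pos (x := a / b) (by positivity)
    (by rw [Ne, div_eq_one_iff_eq hb.ne']; exact hab.ne)
  have h2 : Real.log (b / a) = - Real.log (a / b) := by
    rw [← Real.log_inv, inv_div]
  unfold logNum
  rw [h2]
  have := mul_lt_mul_of_pos_left h hb
  have e : b * (a / b - 1) = a - b := by field_simp
  linarith

lemma logLottery_Iic {μ σ : ℝ} (hμ : 0 < μ) (hσ : 0 < σ) {x : ℝ}
    (hx : x ∈ Set.Icc (logParams μ σ).1 (logParams μ σ).2) :
    logLottery μ σ (Set.Iic x) = ENNReal.ofReal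
      (logNum (logParams μ σ).1 (logParams μ σ).2 x /
        logNum (logParams μ σ).1 (logParams μ σ).2 (logParams μ σ).2) := by
  have hlt := logParams_lt hμ hσ
  have h0 := (isLogParams_logParams hμ σ).1
  rw [logLottery, if_pos ⟨hμ, hσ⟩]
  generalize (logParams μ σ).1 = a at *
  generalize (logParams μ σ).2 = b at *
  have hK := logNum_pos h0 hlt
  have hset : Set.Iic x ∩ Set.Icc a b = Set.Icc a x := by
    ext y
    simp only [Set.mem_inter_iff, Set.mem_Iic, Set.mem_Icc]
    constructor
    · rintro ⟨h1, h2, -⟩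
      exact ⟨h2, h1⟩
    · rintro ⟨h1, h2⟩
      exact ⟨h2, h1, h2.trans hx.2⟩
  rw [withDensity_apply _ measurableSet_Iic, Measure.restrict_restrict measurableSet_Iic, hset]
  have hcont : ContinuousOn (logDensity a b) (Set.Icc a x) := by
    intro y hy
    have hy0 : y ≠ 0 := (h0.trans_le hy.1).ne'
    exact (((continuousAt_const.div continuousAt_id hy0).sub
      continuousAt_const).div_const _).continuousWithinAt
  have hint : IntegrableOn (logDensity a b) (Set.Icc a x) := hcont.integrableOn_Icc
  have hnn : ∀ y ∈ Set.Icc a x, 0 ≤ logDensity a b y := by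
    intro y hy
    have hy0 : 0 < y := h0.trans_le hy.1
    refine div_nonneg ?_ hK.le
    rw [sub_nonneg, le_div_iff₀ hy0]
    linarith [hy.2, hx.2]
  rw [← ofReal_integral_eq_lintegral_ofReal hint
    ((ae_restrict_iff' measurableSet_Icc).2 (Filter.Eventually.of_forall hnn))]
  congr 1
  rw [integral_Icc_eq_integral_Ioc, ← intervalIntegral.integral_of_le hx.1]
  rw [intervalIntegral.integral_eq_sub_of_hasDerivAt
    (f := fun y => logNum a b y / logNum a b b)]
  · have : logNum a b a = 0 := by simp [logNum, h0.ne']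
    rw [this]
    simp
  · intro y hy
    rw [Set.uIcc_of_le hx.1] at hy
    have hy0 : 0 < y := h0.trans_le hy.1
    have h1 : HasDerivAt (fun y : ℝ => Real.log (y / a)) (1 / y) y := by
      have := ((hasDerivAt_id y).div_const a).log (by simp; exact ⟨hy0.ne', h0.ne'⟩)
      refine this.congr_deriv ?_
      simp only [id]
      field_simp
    have h2 := ((h1.const_mul b).sub ((hasDerivAt_id y).sub_const a)).div_const (logNum a b b)
    refine h2.congr_deriv ?_
    simp only [logDensity]
    ring
  · rw [intervalIntegrable_iff_integrableOn_Icc_of_le hx.1]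
    exact hint

instance isProbabilityMeasure_logLottery (μ σ : ℝ) : IsProbabilityMeasure (logLottery μ σ) := by
  by_cases h : 0 < μ ∧ 0 < σ
  · have hlt := logParams_lt h.1 h.2
    have hK := logNum_pos (isLogParams_logParams h.1 σ).1 hlt
    have h1 := logLottery_Iic h.1 h.2 ⟨hlt.le, le_rfl⟩
    rw [div_self hK.ne', ENNReal.ofReal_one] at h1
    refine ⟨?_⟩
    rw [← h1]
    rw [logLottery, if_pos h]
    generalize (logParams μ σ).1 = a at *
    generalize (logParams μ σ).2 = b at *
    rw [withDensity_apply _ MeasurableSet.univ, withDensity_apply _ measurableSet_Iic,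
      Measure.restrict_restrict measurableSet_Iic, Measure.restrict_restrict MeasurableSet.univ]
    congr 2
    ext y
    simp only [Set.mem_inter_iff, Set.mem_univ, Set.mem_Iic, Set.mem_Icc]
    tauto
  · rw [logLottery, if_neg h]
    infer_instance

/-- The cdf of the log-lottery is the expected one. -/
lemma cdf_logLottery {μ σ : ℝ} (hμ : 0 < μ) (hσ : 0 < σ) {x : ℝ}
    (hx : x ∈ Set.Icc (logParams μ σ).1 (logParams μ σ).2) :
    cdf (logLottery μ σ) x =
      logNum (logParams μ σ).1 (logParams μ σ).2 x /
        logNum (logParams μ σ).1 (logParams μ σ).2 (logParams μ σ).2 := by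
  have h := logLottery_Iic hμ hσ hx
  rw [← ofReal_cdf] at h
  have h0 := (isLogParams_logParams hμ σ).1
  have hlt := logParams_lt hμ hσ
  generalize (logParams μ σ).1 = a at *
  generalize (logParams μ σ).2 = b at *
  have hx0 : 0 < x := h0.trans_le hx.1
  refine (ENNReal.ofReal_eq_ofReal_iff (cdf_nonneg _ _) (div_nonneg ?_ (logNum_pos h0 hlt).le)).1 h
  have h2 : Real.log (x / a) = - Real.log (a / x) := by
    rw [← Real.log_inv, inv_div]
  have h3 := Real.log_le_sub_one_of_pos (x := a / x) (by positivity)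
  have h4 : x * (a / x - 1) = a - x := by field_simp
  have h5 := mul_le_mul_of_nonneg_left h3 hx0.le
  have h6 : Real.log (a / x) ≤ 0 :=
    Real.log_nonpos (by positivity) ((div_le_one hx0).2 hx.1)
  unfold logNum
  rw [h2]
  nlinarith [hx.2]

/-! ### Valuation distributions -/

/-- Regularity: `F` has a density `f`, supported on an interval `D` of nonnegative reals, and the
virtual valuation `x - (1 - F(x)) / f(x)` is nondecreasing on `D`. -/
def IsRegular (F : Measure ℝ) : Prop :=
  ∃ (D : Set ℝ) (f : ℝ → ℝ), D.OrdConnected ∧ D ⊆ Set.Ici 0 ∧ Measurable f ∧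
    (∀ x ∈ D, 0 < f x) ∧ (∀ x ∉ D, f x = 0) ∧
    F = volume.withDensity (fun x => ENNReal.ofReal (f x)) ∧
    MonotoneOn (fun x => x - (1 - cdf F x) / f x) D

/-- `F` is `(μ, σ)`-distributed: nonnegative, with expectation `μ` and (finite) standard deviation
at most `σ`. -/
structure IsMeanStd (F : Measure ℝ) (μ σ : ℝ) : Prop where
  nonneg : ∀ᵐ x ∂F, 0 ≤ x
  memLp : MemLp (fun x : ℝ => x) 2 F
  mean : ∫ x, x ∂F = μ
  std : Real.sqrt (variance (fun x : ℝ => x) F) ≤ σ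

/-! ### Mechanisms and benchmarks -/

variable {n : ℕ}

/-- A (direct, possibly randomized) mechanism: from the vector of bids to the winning
probabilities and the (expected) payments of the bidders. -/
structure Mechanism (n : ℕ) where
  alloc : (Fin n → ℝ) → Fin n → ℝ
  pay : (Fin n → ℝ) → Fin n → ℝ

/-- The (randomized) feasible allocations: vectors of winning probabilities of a random
independent set of `M`. -/
def feasible (M : Matroid (Fin n)) : Set (Fin n → ℝ) :=
  convexHull ℝ {x | ∃ S : Finset (Fin n), M.Indep (S : Set (Fin n)) ∧
    x = Set.indicator (S : Set (Fin n)) (fun _ => (1 : ℝ))}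

/-- Expected utility of bidder `i` with value `t` who bids `b`, the others bidding truthfully. -/
def Mechanism.utility (A : Mechanism n) (F : Fin n → Measure ℝ) (i : Fin n) (t b : ℝ) : ℝ :=
  ∫ v, (t * A.alloc (Function.update v i b) i - A.pay (Function.update v i b) i) ∂(Measure.pi F)

/-- Feasible, truthful (Bayesian incentive compatible) and (interim) individually rational
mechanisms. In particular these include the dominant-strategy truthful, ex-post individually
rational mechanisms with nonnegative payments. -/
structure Mechanism.IsTruthful (A : Mechanism n) (M : Matroid (Fin n))
    (F : Fin n → Measure ℝ) : Prop where
  measurable_alloc : Measurable A.alloc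
  measurable_pay : Measurable A.pay
  feasible : ∀ v, (∀ i, 0 ≤ v i) → A.alloc v ∈ feasible M
  integrable_pay : ∀ i, Integrable (fun v => A.pay v i) (Measure.pi F)
  integrable_interim : ∀ i, ∀ b, 0 ≤ b →
    Integrable (fun v => A.pay (Function.update v i b) i) (Measure.pi F)
  incentive_compatible : ∀ i, ∀ t, 0 ≤ t → ∀ b, 0 ≤ b →
    A.utility F i t b ≤ A.utility F i t t
  individually_rational : ∀ i, ∀ t, 0 ≤ t → 0 ≤ A.utility F i t t

def Mechanism.revenue (A : Mechanism n) (F : Fin n → Measure ℝ) : ℝ :=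
  ∫ v, ∑ i, A.pay v i ∂(Measure.pi F)

def Mechanism.welfare (A : Mechanism n) (F : Fin n → Measure ℝ) : ℝ :=
  ∫ v, ∑ i, A.alloc v i * v i ∂(Measure.pi F)

/-- The optimal revenue. -/
def optRevenue (M : Matroid (Fin n)) (F : Fin n → Measure ℝ) : EReal :=
  ⨆ (A : Mechanism n) (_ : A.IsTruthful M F), ((A.revenue F : ℝ) : EReal)

/-- The optimal welfare. -/
def optWelfare (M : Matroid (Fin n)) (F : Fin n → Measure ℝ) : EReal :=
  ⨆ (A : Mechanism n) (_ : A.IsTruthful M F), ((A.welfare F : ℝ) : EReal)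

/-! ### Lazy-VCG -/

/-- `W` selects, at every profile of bids, a welfare-maximizing feasible set (with arbitrary
tie-breaking). -/
def IsVCGRule (M : Matroid (Fin n)) (W : (Fin n → ℝ) → Finset (Fin n)) : Prop :=
  ∀ v, (∀ i, 0 ≤ v i) → M.Indep (W v : Set (Fin n)) ∧
    ∀ S : Finset (Fin n), M.Indep (S : Set (Fin n)) → ∑ j ∈ S, v j ≤ ∑ j ∈ W v, v j

/-- The VCG payment of a winner `i ∈ W v`: the externality imposed on the others, i.e. the maximal
welfare in the absence of `i` minus the welfare of the others at `W v`. -/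
def vcgPayment (M : Matroid (Fin n)) (W : (Fin n → ℝ) → Finset (Fin n)) (v : Fin n → ℝ)
    (i : Fin n) : ℝ :=
  (⨆ S : {S : Finset (Fin n) // M.Indep (S : Set (Fin n)) ∧ i ∉ S}, ∑ j ∈ S.1, v j)
    - ∑ j ∈ (W v).erase i, v j

/-- The take-it-or-leave-it price offered to a candidate winner `i` with reserve `p i`: she has to
pay at least her VCG payment and at least her reserve. -/
def lazyPrice (M : Matroid (Fin n)) (W : (Fin n → ℝ) → Finset (Fin n)) (v p : Fin n → ℝ)
    (i : Fin n) : ℝ :=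
  max (vcgPayment M W v i) (p i)

/-- Bidder `i` wins in Lazy-VCG: she is a candidate winner and accepts the price offered. -/
def lazyWins (M : Matroid (Fin n)) (W : (Fin n → ℝ) → Finset (Fin n)) (v p : Fin n → ℝ)
    (i : Fin n) : Prop :=
  i ∈ W v ∧ lazyPrice M W v p i ≤ v i

open Classical in
/-- Expected revenue of Lazy-VCG: values are drawn from `F`, reserves (independently) from `P`. -/
def lazyRevenue (M : Matroid (Fin n)) (W : (Fin n → ℝ) → Finset (Fin n))
    (F P : Fin n → Measure ℝ) : ℝ :=
  ∫ q : (Fin n → ℝ) × (Fin n → ℝ),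
    ∑ i, (if lazyWins M W q.1 q.2 i then lazyPrice M W q.1 q.2 i else 0)
    ∂((Measure.pi F).prod (Measure.pi P))

open Classical in
/-- Expected welfare of Lazy-VCG. -/
def lazyWelfare (M : Matroid (Fin n)) (W : (Fin n → ℝ) → Finset (Fin n))
    (F P : Fin n → Measure ℝ) : ℝ :=
  ∫ q : (Fin n → ℝ) × (Fin n → ℝ),
    ∑ i, (if lazyWins M W q.1 q.2 i then q.1 i else 0)
    ∂((Measure.pi F).prod (Measure.pi P))

end LazyVCG

end

/-! Write `R x` for the revenue of posting `x` to a single bidder and `t` for her critical value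
given the others' bids. By Myerson's argument (`integral_pay_le_virtual`) a truthful mechanism earns
at most its expected virtual surplus. This is linear in the allocation, so pointwise it suffices to
consider an independent set `S`. Its members inside the VCG set `W` contribute at most their
positive virtual values. Those outside contribute at most their values, and by base exchange these
are covered by the VCG payments of `W` (`IsVCGRule.sum_sdiff_le`). Hence OPT is at most the expected
sum over `W` of positive virtual value plus `t`.

Almost surely a bidder who is not a loop lies in `W` iff her value is at least `t`, and `t` does not
depend on her own value, so the rest concerns a single bidder. Above `t` the two terms integrate to
at most `R x` for some `x ≥ t`, and to `R t`, while Lazy-VCG earns the mean of `R (max t p)` over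
the lottery. Each term is at most `ρ` times this mean, whence `2ρ`. To see this, quasi-concavity of
`R` and `R ≤ μ` give `R p * R x ≤ μ * R (max t p)` (`IsSingleCrossing.priceRevenue_mul_le`). Now
average over `p`, using that the lottery alone earns at least `π₁ = μ / ρ`
(`fst_le_integral_priceRevenue`, `logParams_fst`).

For welfare, VCG is pointwise optimal, and the same averaging works with the truncated mean above
`x`, which dominates `R x`, in place of `R x`. It is monotone in `x`, so quasi-concavity is not
needed and there is no factor 2. -/

noncomputable section

namespace LazyVCG

/-! ### Base exchange in matroids -/

/-- For a base `B` and an independent set `I` there is an injection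
`I \ B → B \ I` along which single elements of `B` can be exchanged. -/
lemma exists_injective_exchange {α : Type*} [DecidableEq α] (M : Matroid α) {B I : Finset α}
    (hB : M.IsBase (B : Set α)) (hI : M.Indep (I : Set α)) :
    ∃ g : {i // i ∈ I \ B} → α, Function.Injective g ∧
      ∀ i, g i ∈ B \ I ∧ M.Indep (insert i.1 ((B : Set α) \ {g i})) := by
  classical
  let t : {i // i ∈ I \ B} → Finset α := fun i =>
    (B \ I).filter fun j => M.Indep (insert i.1 ((B : Set α) \ {j}))
  -- Hall's condition. By its fundamental circuit, each element of `X` is spanned by its neighbours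
  -- together with `I ∩ B`. Comparing ranks and cancelling the common part `I ∩ B` bounds `X.card`
  -- by the number of neighbours.
  have key : ∀ s : Finset {i // i ∈ I \ B}, s.card ≤ (s.biUnion t).card := by
    intro s
    set X : Finset α := s.map (Function.Embedding.subtype _) with hX
    have hXI : ∀ x ∈ X, x ∈ I ∧ x ∉ B := by
      intro x hx
      obtain ⟨a, -, rfl⟩ := Finset.mem_map.1 hx
      exact Finset.mem_sdiff.1 a.2
    set N := s.biUnion t
    have hsub : (X ∪ (I ∩ B) : Finset α) ⊆ I := by
      intro x hx
      rcases Finset.mem_union.1 hx with h | h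
      · exact (hXI x h).1
      · exact (Finset.mem_inter.1 h).1
    have hind : M.Indep ((X ∪ (I ∩ B) : Finset α) : Set α) :=
      hI.subset (Finset.coe_subset.2 hsub)
    have hNB : ((N ∪ (I ∩ B) : Finset α) : Set α) ⊆ B := by
      intro x hx
      rcases Finset.mem_union.1 (Finset.mem_coe.1 hx) with h | h
      · obtain ⟨a, -, ha⟩ := Finset.mem_biUnion.1 h
        exact (Finset.mem_sdiff.1 (Finset.mem_filter.1 ha).1).1
      · exact (Finset.mem_inter.1 h).2
    have hcl : ((X ∪ (I ∩ B) : Finset α) : Set α) ⊆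
        M.closure ((N ∪ (I ∩ B) : Finset α) : Set α) := by
      intro x hx
      rcases Finset.mem_union.1 (Finset.mem_coe.1 hx) with h | h
      · obtain ⟨a, has, rfl⟩ := Finset.mem_map.1 h
        have ha := hXI _ h
        have hE : a.1 ∈ M.E := hI.subset_ground (Finset.mem_coe.2 ha.1)
        have hC := hB.fundCircuit_isCircuit hE (by simpa using ha.2)
        have hmem := hC.mem_closure_sdiff_singleton_of_mem (M.mem_fundCircuit a.1 B)
        refine M.closure_subset_closure ?_ hmem
        intro y hy
        have hyB : y ∈ (B : Set α) :=
          (M.fundCircuit_subset_insert _ _ hy.1).resolve_left hy.2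
        have hcl' : a.1 ∈ M.closure (B : Set α) := by rwa [hB.closure_eq]
        have hyi := (hB.indep.mem_fundCircuit_iff hcl' (by simpa using ha.2)).1 hy.1
        rw [Set.insert_sdiff_of_notMem] at hyi
        · simp only [Finset.coe_union, Set.mem_union, Finset.mem_coe, N, Finset.mem_biUnion, t,
            Finset.mem_filter, Finset.mem_sdiff, Finset.mem_inter]
          by_cases hyI : y ∈ I
          · exact Or.inr ⟨hyI, hyB⟩
          · exact Or.inl ⟨a, has, ⟨hyB, hyI⟩, hyi⟩
        · intro h; exact hy.2 (by simpa using h.symm)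
      · exact M.mem_closure_of_mem (Finset.mem_coe.2 (Finset.mem_union_right _ h))
          (hNB.trans hB.subset_ground)
    have h1 := M.eRk_mono hcl
    rw [Matroid.eRk_closure_eq, hind.eRk_eq_encard, (hB.indep.subset hNB).eRk_eq_encard,
      Set.encard_coe_eq_coe_finsetCard, Set.encard_coe_eq_coe_finsetCard] at h1
    have h2 : (X ∪ (I ∩ B)).card ≤ (N ∪ (I ∩ B)).card := by exact_mod_cast h1
    rw [Finset.card_union_of_disjoint] at h2
    · have h3 := Finset.card_union_le N (I ∩ B)
      have : X.card = s.card := Finset.card_map _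
      omega
    · rw [Finset.disjoint_left]
      intro x hx hx'
      exact (hXI x hx).2 (Finset.mem_inter.1 hx').2
  obtain ⟨g, hg, hgt⟩ := (Finset.all_card_le_biUnion_card_iff_exists_injective t).1 key
  exact ⟨g, hg, fun i => ⟨(Finset.mem_filter.1 (hgt i)).1, (Finset.mem_filter.1 (hgt i)).2⟩⟩

variable {n : ℕ}

/-! ### Critical values and VCG payments -/

/-- The maximal value of an independent set avoiding `i`. -/
def valueWithout (M : Matroid (Fin n)) (i : Fin n) (v : Fin n → ℝ) : ℝ :=
  ⨆ S : {S : Finset (Fin n) // M.Indep (S : Set (Fin n)) ∧ i ∉ S}, ∑ j ∈ S.1, v j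

/-- The maximal value for the others of an independent set containing `i`. -/
def othersValueWith (M : Matroid (Fin n)) (i : Fin n) (v : Fin n → ℝ) : ℝ :=
  ⨆ S : {S : Finset (Fin n) // M.Indep (S : Set (Fin n)) ∧ i ∈ S}, ∑ j ∈ S.1.erase i, v j

/-- The critical value of bidder `i`, as a function of the values of the others. -/
def threshold (M : Matroid (Fin n)) (i : Fin n) (v : Fin n → ℝ) : ℝ :=
  max 0 (valueWithout M i v - othersValueWith M i v)

lemma threshold_nonneg (M : Matroid (Fin n)) (i : Fin n) (v : Fin n → ℝ) :
    0 ≤ threshold M i v := le_max_left _ _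

lemma measurable_threshold (M : Matroid (Fin n)) (i : Fin n) : Measurable (threshold M i) := by
  refine measurable_const.max (Measurable.sub ?_ ?_)
  · exact Measurable.iSup fun S => Finset.measurable_fun_sum _ fun j _ => measurable_pi_apply j
  · exact Measurable.iSup fun S => Finset.measurable_fun_sum _ fun j _ => measurable_pi_apply j

lemma threshold_update (M : Matroid (Fin n)) (i : Fin n) (v : Fin n → ℝ) (y : ℝ) :
    threshold M i (Function.update v i y) = threshold M i v := by
  have h1 : valueWithout M i (Function.update v i y) = valueWithout M i v := by
    unfold valueWithout
    congr 1
    funext S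
    refine Finset.sum_congr rfl fun j hj => Function.update_of_ne ?_ _ _
    rintro rfl
    exact S.2.2 hj
  have h2 : othersValueWith M i (Function.update v i y) = othersValueWith M i v := by
    unfold othersValueWith
    congr 1
    funext S
    exact Finset.sum_congr rfl fun j hj => Function.update_of_ne (Finset.ne_of_mem_erase hj) _ _
  rw [threshold, threshold, h1, h2]

lemma le_valueWithout {M : Matroid (Fin n)} {i : Fin n} (v : Fin n → ℝ) {S : Finset (Fin n)}
    (hS : M.Indep (S : Set (Fin n))) (hi : i ∉ S) : ∑ j ∈ S, v j ≤ valueWithout M i v :=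
  le_ciSup (f := fun S : {S : Finset (Fin n) // M.Indep (S : Set (Fin n)) ∧ i ∉ S} =>
    ∑ j ∈ S.1, v j) (Set.finite_range _).bddAbove ⟨S, hS, hi⟩

lemma le_othersValueWith {M : Matroid (Fin n)} {i : Fin n} (v : Fin n → ℝ) {S : Finset (Fin n)}
    (hS : M.Indep (S : Set (Fin n))) (hi : i ∈ S) :
    ∑ j ∈ S.erase i, v j ≤ othersValueWith M i v :=
  le_ciSup (f := fun S : {S : Finset (Fin n) // M.Indep (S : Set (Fin n)) ∧ i ∈ S} =>
    ∑ j ∈ S.1.erase i, v j) (Set.finite_range _).bddAbove ⟨S, hS, hi⟩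

lemma IsVCGRule.indep_singleton {M : Matroid (Fin n)} {W : (Fin n → ℝ) → Finset (Fin n)}
    (hW : IsVCGRule M W) {v : Fin n → ℝ} (hv : ∀ i, 0 ≤ v i) {i : Fin n} (hi : i ∈ W v) :
    M.Indep {i} :=
  (hW v hv).1.subset (by simpa using hi)

/-- By optimality, the rest of `W v` is the best company for `i`. Removing `i` from `W v` gives a
set that competes in `valueWithout`, so the truncation at `0` is inactive. -/
lemma IsVCGRule.vcgPayment_eq {M : Matroid (Fin n)} {W : (Fin n → ℝ) → Finset (Fin n)}
    (hW : IsVCGRule M W) {v : Fin n → ℝ} (hv : ∀ i, 0 ≤ v i) {i : Fin n} (hi : i ∈ W v) :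
    vcgPayment M W v i = threshold M i v := by
  obtain ⟨hind, hmax⟩ := hW v hv
  have h1 : ∑ j ∈ (W v).erase i, v j = othersValueWith M i v := by
    refine le_antisymm (le_othersValueWith v hind hi) ?_
    have : Nonempty {S : Finset (Fin n) // M.Indep (S : Set (Fin n)) ∧ i ∈ S} :=
      ⟨⟨W v, hind, hi⟩⟩
    refine ciSup_le fun S => ?_
    have h2 := hmax S.1 S.2.1
    rw [← Finset.add_sum_erase _ _ hi, ← Finset.add_sum_erase _ _ S.2.2] at h2
    linarith
  have h2 : 0 ≤ valueWithout M i v - othersValueWith M i v := by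
    rw [← h1, sub_nonneg]
    exact le_valueWithout v (hind.subset (Finset.coe_subset.2 (Finset.erase_subset _ _)))
      (Finset.notMem_erase _ _)
  rw [threshold, max_eq_right h2, vcgPayment, h1]
  rfl

lemma IsVCGRule.threshold_le {M : Matroid (Fin n)} {W : (Fin n → ℝ) → Finset (Fin n)}
    (hW : IsVCGRule M W) {v : Fin n → ℝ} (hv : ∀ i, 0 ≤ v i) {i : Fin n} (hi : i ∈ W v) :
    threshold M i v ≤ v i := by
  obtain ⟨hind, hmax⟩ := hW v hv
  rw [← hW.vcgPayment_eq hv hi, vcgPayment, sub_le_iff_le_add, Finset.add_sum_erase _ _ hi]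
  have : Nonempty {S : Finset (Fin n) // M.Indep (S : Set (Fin n)) ∧ i ∉ S} :=
    ⟨⟨∅, by simp, by simp⟩⟩
  exact ciSup_le fun S => hmax S.1 S.2.1

/-- Strictness excludes ties. Independence of `{i}` is needed because a loop also has a finite
`threshold`: its `othersValueWith` is a supremum over the empty family, hence `0`. -/
lemma IsVCGRule.mem_of_threshold_lt {M : Matroid (Fin n)} {W : (Fin n → ℝ) → Finset (Fin n)}
    (hW : IsVCGRule M W) {v : Fin n → ℝ} (hv : ∀ i, 0 ≤ v i) {i : Fin n}
    (hi : M.Indep {i}) (h : threshold M i v < v i) : i ∈ W v := by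
  obtain ⟨hind, hmax⟩ := hW v hv
  by_contra hiW
  have h1 := le_valueWithout v hind hiW
  have h2 : othersValueWith M i v ≤ ∑ j ∈ W v, v j - v i := by
    have : Nonempty {S : Finset (Fin n) // M.Indep (S : Set (Fin n)) ∧ i ∈ S} :=
      ⟨⟨{i}, by simpa using hi, by simp⟩⟩
    refine ciSup_le fun S => ?_
    have := hmax S.1 S.2.1
    rw [← Finset.add_sum_erase _ _ S.2.2] at this
    linarith
  have h3 : valueWithout M i v - othersValueWith M i v ≤ threshold M i v := le_max_right _ _
  linarith

lemma IsVCGRule.isBase {M : Matroid (Fin n)} {W : (Fin n → ℝ) → Finset (Fin n)}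
    (hW : IsVCGRule M W) {v : Fin n → ℝ} (hv : ∀ i, 0 < v i) :
    M.IsBase (W v : Set (Fin n)) := by
  obtain ⟨hind, hmax⟩ := hW v fun i => (hv i).le
  refine hind.isBase_of_forall_insert fun e he hins => ?_
  have heW : e ∉ W v := fun h => he.2 (Finset.mem_coe.2 h)
  have := hmax (insert e (W v)) (by rwa [Finset.coe_insert])
  rw [Finset.sum_insert heW] at this
  linarith [hv e]

/-- The winners pay at least as much as the losers of any independent set are worth. -/
lemma IsVCGRule.sum_sdiff_le {M : Matroid (Fin n)} {W : (Fin n → ℝ) → Finset (Fin n)}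
    (hW : IsVCGRule M W) {v : Fin n → ℝ} (hv : ∀ i, 0 < v i) {S : Finset (Fin n)}
    (hS : M.Indep (S : Set (Fin n))) :
    ∑ i ∈ S \ W v, v i ≤ ∑ j ∈ W v, threshold M j v := by
  have hv0 : ∀ i, 0 ≤ v i := fun i => (hv i).le
  obtain ⟨g, hg, hgW⟩ := exists_injective_exchange M (hW.isBase hv) hS
  have h1 : ∀ i : {i // i ∈ S \ W v}, v i.1 ≤ threshold M (g i) v := by
    intro i
    obtain ⟨hgi, hins⟩ := hgW i
    have hgi' : g i ∈ W v := by
      have := Finset.mem_sdiff.1 hgi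
      exact this.1
    have hiW : i.1 ∉ W v := (Finset.mem_sdiff.1 i.2).2
    -- Exchanging `g i` for `i` in `W v` leaves an independent set without `g i`, a competitor in
    -- the definition of the payment of `g i`. Injectivity of `g` then ensures that no payment is
    -- charged twice.
    rw [← hW.vcgPayment_eq hv0 hgi', vcgPayment, le_sub_iff_add_le,
      ← Finset.sum_insert (fun h => hiW (Finset.mem_of_mem_erase h))]
    refine le_valueWithout v ?_ ?_
    · rwa [Finset.coe_insert, Finset.coe_erase]
    · simp only [Finset.mem_insert, Finset.mem_erase, ne_eq, not_true, false_and, or_false]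
      intro h
      exact hiW (h ▸ hgi')
  calc ∑ i ∈ S \ W v, v i = ∑ i : {i // i ∈ S \ W v}, v i.1 :=
        (Finset.sum_coe_sort (S \ W v) v).symm
    _ ≤ ∑ i : {i // i ∈ S \ W v}, threshold M (g i) v := Finset.sum_le_sum fun i _ => h1 i
    _ = ∑ j ∈ Finset.univ.image g, threshold M j v :=
        (Finset.sum_image (f := fun j => threshold M j v) (g := g) fun a _ b _ h => hg h).symm
    _ ≤ ∑ j ∈ W v, threshold M j v := by
        refine Finset.sum_le_sum_of_subset_of_nonneg ?_ fun j _ _ => threshold_nonneg M j v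
        intro j hj
        obtain ⟨i, -, rfl⟩ := Finset.mem_image.1 hj
        have := Finset.mem_sdiff.1 (hgW i).1
        exact this.1

lemma sum_mul_indicator (c : Fin n → ℝ) (S : Finset (Fin n)) :
    ∑ i, c i * Set.indicator (S : Set (Fin n)) (fun _ => (1 : ℝ)) i = ∑ i ∈ S, c i := by
  classical
  simp [Set.indicator_apply]

lemma sum_mul_le_of_mem_feasible {M : Matroid (Fin n)} {x c : Fin n → ℝ} {B : ℝ}
    (hx : x ∈ feasible M)
    (h : ∀ S : Finset (Fin n), M.Indep (S : Set (Fin n)) → ∑ i ∈ S, c i ≤ B) :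
    ∑ i, c i * x i ≤ B := by
  have hconv : Convex ℝ {x : Fin n → ℝ | ∑ i, c i * x i ≤ B} := by
    refine convex_halfSpace_le ⟨fun a b => ?_, fun r a => ?_⟩ B
    · simp [mul_add, Finset.sum_add_distrib]
    · simp only [Pi.smul_apply, smul_eq_mul, Finset.mul_sum]
      exact Finset.sum_congr rfl fun i _ => by ring
  refine convexHull_min ?_ hconv hx
  rintro _ ⟨S, hS, rfl⟩
  rw [Set.mem_ofPred_eq, sum_mul_indicator]
  exact h S hS

lemma mem_Icc_of_mem_feasible {M : Matroid (Fin n)} {x : Fin n → ℝ}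
    (hx : x ∈ feasible M) : x ∈ Set.Icc (0 : Fin n → ℝ) 1 := by
  refine convexHull_min ?_ (convex_Icc 0 1) hx
  rintro _ ⟨S, hS, rfl⟩
  constructor
  · exact fun i => Set.indicator_nonneg (fun _ _ => zero_le_one) i
  · exact fun i => Set.indicator_le' (fun _ _ => le_rfl) (fun _ _ => zero_le_one) i

/-- A linear functional on the feasible polytope is bounded by its values at the independent sets
`S`. On `S ∩ W v` use the positive part of `c`; on `S \ W v` use `c ≤ v` and let the payments of `W
v` cover the values. -/
lemma IsVCGRule.sum_virtual_le {M : Matroid (Fin n)} {W : (Fin n → ℝ) → Finset (Fin n)}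
    (hW : IsVCGRule M W) {v : Fin n → ℝ} (hv : ∀ i, 0 < v i) {x c : Fin n → ℝ}
    (hx : x ∈ feasible M) (hc : ∀ i, c i ≤ v i) :
    ∑ i, c i * x i ≤ ∑ i ∈ W v, (max (c i) 0 + threshold M i v) := by
  classical
  refine sum_mul_le_of_mem_feasible hx fun S hS => ?_
  rw [← Finset.sum_inter_add_sum_sdiff S (W v), Finset.sum_add_distrib]
  refine add_le_add ?_ ((Finset.sum_le_sum fun i _ => hc i).trans (hW.sum_sdiff_le hv hS))
  calc ∑ i ∈ S ∩ W v, c i ≤ ∑ i ∈ S ∩ W v, max (c i) 0 :=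
        Finset.sum_le_sum fun i _ => le_max_left _ _
    _ ≤ ∑ i ∈ W v, max (c i) 0 :=
        Finset.sum_le_sum_of_subset_of_nonneg Finset.inter_subset_right
          fun i _ _ => le_max_right _ _

/-! ### Layer-cake formula and the sign condition from regularity -/

/-- Layer-cake formula for the primitive of a monotone bounded function. -/
lemma integral_primitive_eq {F : Measure ℝ} [IsProbabilityMeasure F] (hpos : ∀ᵐ x ∂F, 0 ≤ x)
    (hint : Integrable (fun x : ℝ => x) F) {X : ℝ → ℝ} (hX : Monotone X)
    (h0 : ∀ x, 0 ≤ X x) (h1 : ∀ x, X x ≤ 1) :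
    Integrable (fun y => ∫ t in (0 : ℝ)..y, X t) F ∧
    IntegrableOn (fun t => F.real (Set.Ioi t) * X t) (Set.Ioi 0) ∧
    ∫ y, (∫ t in (0 : ℝ)..y, X t) ∂F = ∫ t in Set.Ioi 0, F.real (Set.Ioi t) * X t := by
  have hII : ∀ a b, IntervalIntegrable X volume a b := fun a b => hX.intervalIntegrable
  have hcont : Continuous fun y => ∫ t in (0 : ℝ)..y, X t :=
    intervalIntegral.continuous_primitive hII 0
  have hnn : ∀ y, 0 ≤ y → 0 ≤ ∫ t in (0 : ℝ)..y, X t := fun y hy =>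
    intervalIntegral.integral_nonneg hy fun u _ => h0 u
  have hle : ∀ y, 0 ≤ y → ∫ t in (0 : ℝ)..y, X t ≤ y := fun y hy => by
    calc ∫ t in (0 : ℝ)..y, X t ≤ ∫ _ in (0 : ℝ)..y, (1 : ℝ) :=
          intervalIntegral.integral_mono_on hy (hII _ _) intervalIntegrable_const fun u _ => h1 u
      _ = y := by simp
  have hI : Integrable (fun y => ∫ t in (0 : ℝ)..y, X t) F := by
    refine hint.mono' hcont.aestronglyMeasurable ?_
    filter_upwards [hpos] with y hy
    rw [Real.norm_of_nonneg (hnn y hy)]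
    exact hle y hy
  have key := lintegral_comp_eq_lintegral_meas_lt_mul F (f := fun x : ℝ => x) (g := X) hpos
    measurable_id.aemeasurable (fun t _ => hII 0 t) (Filter.Eventually.of_forall h0)
  have hmeas : Measurable fun t => F.real (Set.Ioi t) * X t := by
    refine Measurable.mul (Antitone.measurable fun a b hab => ?_) hX.measurable
    exact measureReal_mono (Set.Ioi_subset_Ioi hab)
  have hconv : ∀ t, F {a | t < a} * ENNReal.ofReal (X t)
      = ENNReal.ofReal (F.real (Set.Ioi t) * X t) := fun t => by
    rw [ENNReal.ofReal_mul measureReal_nonneg, ofReal_measureReal]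
    rfl
  simp_rw [hconv] at key
  have hnn2 : ∀ t, 0 ≤ F.real (Set.Ioi t) * X t := fun t => mul_nonneg measureReal_nonneg (h0 t)
  refine ⟨hI, ⟨hmeas.aestronglyMeasurable, ?_⟩, ?_⟩
  · rw [hasFiniteIntegral_iff_ofReal (Filter.Eventually.of_forall hnn2), ← key]
    exact hI.lintegral_lt_top
  · rw [integral_eq_lintegral_of_nonneg_ae (hpos.mono hnn) hI.aestronglyMeasurable, key,
      integral_eq_lintegral_of_nonneg_ae (Filter.Eventually.of_forall hnn2)
        hmeas.aestronglyMeasurable]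

/-- `f` is a density of `F`, a distribution on the nonnegative reals with finite expectation, and
`y f(y) - (1 - F(y))`, the derivative of the revenue curve up to sign, changes sign only once. -/
structure IsSingleCrossing (F : Measure ℝ) (f : ℝ → ℝ) : Prop where
  measurable : Measurable f
  nonneg : ∀ x, 0 ≤ f x
  eq_withDensity : F = volume.withDensity (fun x => ENNReal.ofReal (f x))
  ae_nonneg : ∀ᵐ x ∂F, 0 ≤ x
  integrable : Integrable (fun x : ℝ => x) F
  crossing : ∀ y z, 0 ≤ y → y ≤ z → 0 < f y * y - F.real (Set.Ioi y) →
    0 ≤ f z * z - F.real (Set.Ioi z)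

lemma one_sub_cdf_eq (F : Measure ℝ) [IsProbabilityMeasure F] (y : ℝ) :
    1 - cdf F y = F.real (Set.Ioi y) := by
  rw [cdf_eq_real, ← probReal_compl_eq_one_sub measurableSet_Iic, Set.compl_Iic]

/-- A positive sign at `y` puts `y` in `D`. Later points of `D` inherit it from the monotone virtual
value; beyond `D` there is no mass, so both terms vanish. -/
lemma IsRegular.exists_isSingleCrossing {F : Measure ℝ} [IsProbabilityMeasure F]
    (h : IsRegular F) (hpos : ∀ᵐ x ∂F, 0 ≤ x) (hint : Integrable (fun x : ℝ => x) F) :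
    ∃ f, IsSingleCrossing F f := by
  obtain ⟨D, f, hD, hD0, hf, hfpos, hf0, hF, hmono⟩ := h
  refine ⟨f, hf, fun x => ?_, hF, hpos, hint, fun y z hy hyz hψ => ?_⟩
  · by_cases hx : x ∈ D
    · exact (hfpos x hx).le
    · exact (hf0 x hx).ge
  have hyD : y ∈ D := by
    by_contra hyD
    rw [hf0 y hyD] at hψ
    have : 0 ≤ F.real (Set.Ioi y) := measureReal_nonneg
    linarith
  by_cases hzD : z ∈ D
  · have h1 := hmono hyD hzD hyz
    simp only [one_sub_cdf_eq] at h1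
    have hfy := hfpos y hyD
    have hfz := hfpos z hzD
    have h2 : 0 < y - F.real (Set.Ioi y) / f y := by
      rw [sub_pos, div_lt_iff₀ hfy]
      linarith
    have h3 : 0 ≤ z - F.real (Set.Ioi z) / f z := h2.le.trans h1
    rw [sub_nonneg, div_le_iff₀ hfz] at h3
    linarith
  · have hIoi : F (Set.Ioi z) = 0 := by
      rw [hF, withDensity_apply _ measurableSet_Ioi]
      rw [setLIntegral_congr_fun measurableSet_Ioi (g := fun _ => 0)]
      · simp
      intro w hw
      have hwD : w ∉ D := fun hwD => hzD (hD.out hyD hwD ⟨hyz, (Set.mem_Ioi.1 hw).le⟩)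
      simp [hf0 w hwD]
    simp [measureReal_def, hIoi, hf0 z hzD]

/-! ### Revenue curve and truncated means of one bidder -/

/-- The expected revenue of posting the price `x`. -/
def priceRevenue (F : Measure ℝ) (x : ℝ) : ℝ := x * F.real (Set.Ioi x)

lemma priceRevenue_nonneg (F : Measure ℝ) {x : ℝ} (hx : 0 ≤ x) : 0 ≤ priceRevenue F x :=
  mul_nonneg hx measureReal_nonneg

lemma measurable_real_Ioi (F : Measure ℝ) [IsProbabilityMeasure F] :
    Measurable fun t => F.real (Set.Ioi t) :=
  Antitone.measurable fun _ _ hab => measureReal_mono (Set.Ioi_subset_Ioi hab)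

lemma measurable_priceRevenue (F : Measure ℝ) [IsProbabilityMeasure F] :
    Measurable (priceRevenue F) := measurable_id.mul (measurable_real_Ioi F)

lemma primitive_indicator {x y : ℝ} (hx : 0 ≤ x) (hy : 0 ≤ y) :
    ∫ t in (0 : ℝ)..y, Set.indicator (Set.Ioi x) (fun _ => (1 : ℝ)) t = max (y - x) 0 := by
  rw [intervalIntegral.integral_of_le hy, setIntegral_indicator measurableSet_Ioi]
  have : Set.Ioc 0 y ∩ Set.Ioi x = Set.Ioc x y := by
    ext t
    simp only [Set.mem_inter_iff, Set.mem_Ioc, Set.mem_Ioi]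
    constructor
    · rintro ⟨⟨_, h⟩, h'⟩; exact ⟨h', h⟩
    · rintro ⟨h', h⟩; exact ⟨⟨hx.trans_lt h', h⟩, h'⟩
  rw [this]
  simp [Measure.real, Real.volume_Ioc, ENNReal.toReal_ofReal']

lemma integrableOn_real_Ioi {F : Measure ℝ} [IsProbabilityMeasure F] (hpos : ∀ᵐ x ∂F, 0 ≤ x)
    (hint : Integrable (fun x : ℝ => x) F) :
    IntegrableOn (fun t => F.real (Set.Ioi t)) (Set.Ioi 0) := by
  simpa using (integral_primitive_eq hpos hint (X := fun _ => 1) monotone_const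
    (fun _ => zero_le_one) (fun _ => le_rfl)).2.1

/-- The layer-cake formula for the indicator of `(x, ∞)`, whose primitive is the positive part of `y
- x`. -/
lemma setIntegral_Ioi_eq {F : Measure ℝ} [IsProbabilityMeasure F] (hpos : ∀ᵐ x ∂F, 0 ≤ x)
    (hint : Integrable (fun x : ℝ => x) F) {x : ℝ} (hx : 0 ≤ x) :
    ∫ y in Set.Ioi x, y ∂F = priceRevenue F x + ∫ t in Set.Ioi x, F.real (Set.Ioi t) := by
  have hmono : Monotone (Set.indicator (Set.Ioi x) (fun _ => (1 : ℝ))) := by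
    intro a b hab
    by_cases ha : x < a
    · rw [Set.indicator_of_mem (Set.mem_Ioi.2 ha),
        Set.indicator_of_mem (Set.mem_Ioi.2 (ha.trans_le hab))]
    · rw [Set.indicator_of_notMem (by simpa using ha)]
      exact Set.indicator_nonneg (fun _ _ => zero_le_one) b
  have h := (integral_primitive_eq hpos hint hmono
    (fun t => Set.indicator_nonneg (fun _ _ => zero_le_one) t)
    (fun t => Set.indicator_le' (fun _ _ => le_rfl) (fun _ _ => zero_le_one) t)).2.2
  have h1 : ∫ y, (∫ t in (0 : ℝ)..y, Set.indicator (Set.Ioi x) (fun _ => (1 : ℝ)) t) ∂F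
      = ∫ y in Set.Ioi x, y ∂F - priceRevenue F x := by
    have h2 : ∫ y in Set.Ioi x, (y - x) ∂F = ∫ y in Set.Ioi x, y ∂F - priceRevenue F x := by
      rw [integral_sub hint.integrableOn (integrable_const _)]
      simp [priceRevenue, mul_comm]
    rw [← h2, ← integral_indicator measurableSet_Ioi]
    refine integral_congr_ae ?_
    filter_upwards [hpos] with y hy
    rw [primitive_indicator hx hy]
    by_cases hxy : x < y
    · rw [Set.indicator_of_mem (Set.mem_Ioi.2 hxy), max_eq_left (by linarith)]
    · rw [Set.indicator_of_notMem (by simpa using hxy), max_eq_right (by linarith)]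
  have h3 : ∫ t in Set.Ioi 0, F.real (Set.Ioi t) * Set.indicator (Set.Ioi x) (fun _ => (1 : ℝ)) t
      = ∫ t in Set.Ioi x, F.real (Set.Ioi t) := by
    have : (fun t => F.real (Set.Ioi t) * Set.indicator (Set.Ioi x) (fun _ => (1 : ℝ)) t)
        = Set.indicator (Set.Ioi x) fun t => F.real (Set.Ioi t) := by
      funext t
      by_cases ht : t ∈ Set.Ioi x <;> simp [ht]
    rw [this, setIntegral_indicator measurableSet_Ioi,
      Set.inter_eq_right.2 (Set.Ioi_subset_Ioi hx)]
  rw [h1, h3] at h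
  linarith

namespace IsSingleCrossing

variable {F : Measure ℝ} {f : ℝ → ℝ}

lemma integral_eq (h : IsSingleCrossing F f) (g : ℝ → ℝ) : ∫ y, g y ∂F = ∫ y, f y * g y := by
  conv_lhs => rw [h.eq_withDensity]
  rw [integral_withDensity_eq_integral_toReal_smul h.measurable.ennreal_ofReal
    (Filter.Eventually.of_forall fun _ => ENNReal.ofReal_lt_top)]
  simp [ENNReal.toReal_ofReal (h.nonneg _)]

lemma setIntegral_eq (h : IsSingleCrossing F f) (g : ℝ → ℝ) {s : Set ℝ} (hs : MeasurableSet s) :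
    ∫ y in s, g y ∂F = ∫ y in s, f y * g y := by
  rw [← integral_indicator hs, h.integral_eq, ← integral_indicator hs]
  congr 1
  funext y
  by_cases hy : y ∈ s <;> simp [hy]

lemma integrable_iff (h : IsSingleCrossing F f) {g : ℝ → ℝ} :
    Integrable g F ↔ Integrable fun y => f y * g y := by
  conv_lhs => rw [h.eq_withDensity]
  rw [integrable_withDensity_iff h.measurable.ennreal_ofReal
    (Filter.Eventually.of_forall fun _ => ENNReal.ofReal_lt_top)]
  simp [ENNReal.toReal_ofReal (h.nonneg _), mul_comm]

lemma absolutelyContinuous (h : IsSingleCrossing F f) : F ≪ volume := by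
  rw [h.eq_withDensity]
  exact withDensity_absolutelyContinuous _ _

lemma measure_singleton (h : IsSingleCrossing F f) (x : ℝ) : F {x} = 0 :=
  h.absolutelyContinuous (Real.volume_singleton)

lemma Ici_ae_eq_Ioi (h : IsSingleCrossing F f) (x : ℝ) : Set.Ici x =ᵐ[F] Set.Ioi x :=
  have : NullSingletonClass F := ⟨h.measure_singleton⟩
  Ioi_ae_eq_Ici.symm

lemma ae_pos (h : IsSingleCrossing F f) : ∀ᵐ x ∂F, 0 < x := by
  have : ∀ᵐ x ∂F, x ≠ 0 := by
    rw [ae_iff]; simpa using h.measure_singleton 0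
  filter_upwards [h.ae_nonneg, this] with x h1 h2
  exact lt_of_le_of_ne h1 h2.symm

/-- The virtual value `y - (1 - F(y)) / f(y)`. -/
def _root_.LazyVCG.virtualValue (F : Measure ℝ) (f : ℝ → ℝ) (y : ℝ) : ℝ :=
  y - F.real (Set.Ioi y) / f y

lemma virtualValue_le (h : IsSingleCrossing F f) (y : ℝ) : virtualValue F f y ≤ y :=
  sub_le_self _ (div_nonneg measureReal_nonneg (h.nonneg y))

lemma integrableOn_density_mul (h : IsSingleCrossing F f) (s : Set ℝ) :
    IntegrableOn (fun y => f y * y) s :=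
  (h.integrable_iff.1 h.integrable).integrableOn

/-- This also covers `f y = 0`, where division by zero makes the virtual value equal to `y`: the
factor `f y` kills the left side and the right side truncates a nonpositive number. -/
lemma density_mul_max_virtualValue (h : IsSingleCrossing F f) (y : ℝ) :
    f y * max (virtualValue F f y) 0 = max (f y * y - F.real (Set.Ioi y)) 0 := by
  rcases (h.nonneg y).eq_or_lt with h0 | h0
  · rw [← h0, zero_mul, max_eq_right]
    have : 0 ≤ F.real (Set.Ioi y) := measureReal_nonneg
    linarith
  · rw [mul_max_of_nonneg _ _ h0.le, mul_zero, virtualValue]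
    congr 1
    field_simp

lemma setIntegral_le_integral (h : IsSingleCrossing F f) (x : ℝ) :
    ∫ y in Set.Ioi x, y ∂F ≤ ∫ y, y ∂F :=
  MeasureTheory.setIntegral_le_integral h.integrable h.ae_nonneg

lemma setIntegral_nonneg (h : IsSingleCrossing F f) (x : ℝ) : 0 ≤ ∫ y in Set.Ioi x, y ∂F :=
  integral_nonneg_of_ae (ae_restrict_of_ae h.ae_nonneg)

/-- One factor on the left is already the truncated mean at `max t p`; the other is at most the full
mean. -/
lemma setIntegral_mul_le (h : IsSingleCrossing F f) (t p : ℝ) :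
    (∫ y in Set.Ioi p, y ∂F) * ∫ y in Set.Ioi t, y ∂F
      ≤ (∫ y in Set.Ioi (max t p), y ∂F) * ∫ y, y ∂F := by
  have h1 := h.setIntegral_le_integral p
  have h2 := h.setIntegral_le_integral t
  rcases le_total t p with htp | hpt
  · rw [max_eq_right htp]
    exact mul_le_mul_of_nonneg_left h2 (h.setIntegral_nonneg p)
  · rw [max_eq_left hpt, mul_comm]
    exact mul_le_mul_of_nonneg_left h1 (h.setIntegral_nonneg t)

variable [IsProbabilityMeasure F]

lemma measurable_virtualValue (h : IsSingleCrossing F f) : Measurable (virtualValue F f) :=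
  measurable_id.sub ((measurable_real_Ioi F).div h.measurable)

lemma integrableOn_sub (h : IsSingleCrossing F f) {x : ℝ} (hx : 0 ≤ x) :
    IntegrableOn (fun y => f y * y - F.real (Set.Ioi y)) (Set.Ioi x) :=
  (h.integrableOn_density_mul _).sub
    ((integrableOn_real_Ioi h.ae_nonneg h.integrable).mono_set (Set.Ioi_subset_Ioi hx))

/-- The integrand is formally minus the derivative of the revenue curve. Going through the
layer-cake formula avoids differentiating it. -/
lemma setIntegral_Ioi_sub (h : IsSingleCrossing F f) {x : ℝ} (hx : 0 ≤ x) :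
    ∫ y in Set.Ioi x, (f y * y - F.real (Set.Ioi y)) = priceRevenue F x := by
  rw [integral_sub (h.integrableOn_density_mul _)
    ((integrableOn_real_Ioi h.ae_nonneg h.integrable).mono_set (Set.Ioi_subset_Ioi hx)),
    ← h.setIntegral_eq (fun y => y) measurableSet_Ioi,
    setIntegral_Ioi_eq h.ae_nonneg h.integrable hx]
  ring

lemma setIntegral_Ioc_sub (h : IsSingleCrossing F f) {a b : ℝ} (ha : 0 ≤ a) (hab : a ≤ b) :
    ∫ y in Set.Ioc a b, (f y * y - F.real (Set.Ioi y)) = priceRevenue F a - priceRevenue F b := by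
  have h1 := setIntegral_union (μ := volume) (Set.Ioc_disjoint_Ioi (le_refl b)) measurableSet_Ioi
    ((h.integrableOn_sub ha).mono_set Set.Ioc_subset_Ioi_self) (h.integrableOn_sub (ha.trans hab))
  rw [Set.Ioc_union_Ioi_eq_Ioi hab, h.setIntegral_Ioi_sub ha,
    h.setIntegral_Ioi_sub (ha.trans hab)] at h1
  linarith

/-- The revenue curve of a regular distribution is quasi-concave. -/
lemma priceRevenue_quasiconcave (h : IsSingleCrossing F f) {a b c : ℝ} (ha : 0 ≤ a) (hab : a ≤ b)
    (hbc : b ≤ c) : priceRevenue F a ≤ priceRevenue F b ∨ priceRevenue F c ≤ priceRevenue F b := by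
  by_contra! hcon
  obtain ⟨h1, h2⟩ := hcon
  -- A strict drop from `a` to `b` forces a positive integrand somewhere in between. It is then
  -- nonnegative from there on, so the curve cannot rise from `b` to `c`.
  have h3 : ∃ y ∈ Set.Ioc a b, 0 < f y * y - F.real (Set.Ioi y) := by
    by_contra! hno
    have := setIntegral_nonpos (μ := volume) measurableSet_Ioc hno
    rw [h.setIntegral_Ioc_sub ha hab] at this
    linarith
  obtain ⟨y, hy, hψ⟩ := h3
  have := MeasureTheory.setIntegral_nonneg (μ := volume) (measurableSet_Ioc (a := b) (b := c)) fun z hz =>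
    h.crossing y z (ha.trans hy.1.le) (hy.2.trans hz.1.le) hψ
  rw [h.setIntegral_Ioc_sub (ha.trans hab) hbc] at this
  linarith

/-- Multiplied by the density, the hazard term is at most the tail, which is Lebesgue integrable
only on the nonnegative half-line; hence the indicators. -/
lemma integrable_virtualValue (h : IsSingleCrossing F f) : Integrable (virtualValue F f) F := by
  refine h.integrable.sub ?_
  have h1 : Integrable (Set.indicator (Set.Ici 0) fun y => F.real (Set.Ioi y)) := by
    rw [integrable_indicator_iff measurableSet_Ici, integrableOn_Ici_iff_integrableOn_Ioi]
    exact integrableOn_real_Ioi h.ae_nonneg h.integrable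
  have h2 : Integrable (Set.indicator (Set.Ici 0) fun y => F.real (Set.Ioi y) / f y) F := by
    rw [h.integrable_iff]
    refine h1.mono ?_ (Filter.Eventually.of_forall fun y => ?_)
    · exact (h.measurable.mul (((measurable_real_Ioi F).div h.measurable).indicator
        measurableSet_Ici)).aestronglyMeasurable
    · by_cases hy : y ∈ Set.Ici (0 : ℝ)
      · simp only [Set.indicator_of_mem hy]
        rcases (h.nonneg y).eq_or_lt with h0 | h0
        · simp [← h0]
        · rw [mul_div_cancel₀ _ h0.ne']
      · simp [hy]
  refine h2.congr ?_
  filter_upwards [h.ae_nonneg] with y hy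
  rw [Set.indicator_of_mem (Set.mem_Ici.2 hy)]

/-- The witness is the first point after `t` where the virtual value turns positive: by single
crossing the truncated integrand vanishes before it and is untruncated after it. If there is no such
point, the integral is zero and `x = t` works. -/
lemma exists_setIntegral_max_le (h : IsSingleCrossing F f) {t : ℝ} (ht : 0 ≤ t) :
    ∃ x, t ≤ x ∧ ∫ y in Set.Ioi t, max (virtualValue F f y) 0 ∂F ≤ priceRevenue F x := by
  rw [h.setIntegral_eq _ measurableSet_Ioi]
  simp_rw [h.density_mul_max_virtualValue]
  set U := {y | t ≤ y ∧ 0 < f y * y - F.real (Set.Ioi y)} with hU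
  rcases U.eq_empty_or_nonempty with hE | hne
  · refine ⟨t, le_rfl, le_trans (le_of_eq ?_) (priceRevenue_nonneg F ht)⟩
    rw [setIntegral_congr_fun measurableSet_Ioi (g := fun _ => 0)]
    · simp
    intro y hy
    refine max_eq_right (not_lt.1 fun hlt => ?_)
    exact Set.eq_empty_iff_forall_notMem.1 hE y ⟨(Set.mem_Ioi.1 hy).le, hlt⟩
  · have hbdd : BddBelow U := ⟨t, fun y hy => hy.1⟩
    have htx : t ≤ sInf U := le_csInf hne fun y hy => hy.1
    refine ⟨sInf U, htx, le_of_eq ?_⟩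
    rw [← h.setIntegral_Ioi_sub (ht.trans htx)]
    have hinter : Set.Ioi t ∩ Set.Ioi (sInf U) = Set.Ioi (sInf U) :=
      Set.inter_eq_right.2 (Set.Ioi_subset_Ioi htx)
    rw [← hinter, ← setIntegral_indicator measurableSet_Ioi]
    refine setIntegral_congr_ae measurableSet_Ioi ?_
    have hne' : ∀ᵐ y : ℝ, y ≠ sInf U := by
      rw [ae_iff]; simp
    filter_upwards [hne'] with y hy hty
    rcases lt_or_gt_of_ne hy with hlt | hgt
    · rw [Set.indicator_of_notMem (by simpa using hlt.le), max_eq_right]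
      exact not_lt.1 fun hpos => (csInf_le hbdd ⟨(Set.mem_Ioi.1 hty).le, hpos⟩).not_gt hlt
    · obtain ⟨u, hu, huy⟩ := exists_lt_of_csInf_lt hne hgt
      rw [Set.indicator_of_mem (Set.mem_Ioi.2 hgt), max_eq_left]
      exact h.crossing u y (ht.trans hu.1) huy.le hu.2

lemma priceRevenue_le_setIntegral (h : IsSingleCrossing F f) (x : ℝ) :
    priceRevenue F x ≤ ∫ y in Set.Ioi x, y ∂F := by
  have h1 : ∫ y in Set.Ioi x, x ∂F ≤ ∫ y in Set.Ioi x, y ∂F :=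
    setIntegral_mono_on (integrable_const _) h.integrable.integrableOn measurableSet_Ioi
      fun y hy => (Set.mem_Ioi.1 hy).le
  simpa [priceRevenue, mul_comm] using h1

lemma priceRevenue_le_mean (h : IsSingleCrossing F f) (x : ℝ) :
    priceRevenue F x ≤ ∫ y, y ∂F :=
  (h.priceRevenue_le_setIntegral x).trans (h.setIntegral_le_integral x)

/-- If `t ≤ p`, bound the revenue at `x` by the mean. Otherwise `p ≤ t ≤ x`, and by quasi-concavity
the revenue at `t` dominates one of the two factors; the other is at most the mean. -/
lemma priceRevenue_mul_le (h : IsSingleCrossing F f) {t p x : ℝ} (hp : 0 ≤ p) (ht : 0 ≤ t)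
    (hx : t ≤ x) :
    priceRevenue F p * priceRevenue F x ≤ priceRevenue F (max t p) * ∫ y, y ∂F := by
  have hRp := priceRevenue_nonneg F hp
  have hRx := priceRevenue_nonneg F (ht.trans hx)
  have hRt := priceRevenue_nonneg F ht
  have h1 := h.priceRevenue_le_mean p
  have h2 := h.priceRevenue_le_mean x
  rcases le_total t p with htp | hpt
  · rw [max_eq_right htp]
    exact mul_le_mul_of_nonneg_left h2 hRp
  · rw [max_eq_left hpt]
    rcases h.priceRevenue_quasiconcave hp hpt hx with hc | hc
    · exact mul_le_mul hc h2 hRx hRt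
    · rw [mul_comm]
      exact mul_le_mul hc h1 hRp hRt

end IsSingleCrossing

/-! ### Guarantee of the log-lottery -/

/-- Eliminating `π₂` from the system leaves the defining equation of `rho` for the ratio `μ / π₁`.
-/
lemma logParams_fst {μ σ : ℝ} (hμ : 0 < μ) : (logParams μ σ).1 = μ / rho (σ / μ) := by
  obtain ⟨ha, hab, h2, h3⟩ := isLogParams_logParams hμ σ
  set a := (logParams μ σ).1
  set b := (logParams μ σ).2
  have hb : 0 < b := ha.trans_le hab
  have hl : Real.log (b / a) = μ / a - 1 := by
    field_simp
    linarith
  have hbe : b / a = Real.exp (μ / a - 1) := by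
    rw [← hl, Real.exp_log (by positivity)]
  have hrho : IsRho (σ / μ) (μ / a) := by
    refine ⟨by positivity, ?_⟩
    rw [← hbe]
    field_simp
    linarith
  rw [(existsUnique_isRho (σ / μ)).unique (isRho_rho _) hrho]
  field_simp

lemma rho_le_rho {r s : ℝ} (hr : 0 ≤ r) (hrs : r ≤ s) : rho r ≤ rho s := by
  obtain ⟨h0, he⟩ := isRho_rho r
  obtain ⟨h0', he'⟩ := isRho_rho s
  refine (strictMonoOn_rhoAux.le_iff_le h0 h0').1 ?_
  rw [he, he']
  gcongr

/-- A distribution with a density has no atoms, so it cannot have zero variance. Hence the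
point-mass case of the lottery never arises. -/
lemma IsMeanStd.std_pos {F : Measure ℝ} [IsProbabilityMeasure F] {f : ℝ → ℝ} {μ σ : ℝ}
    (hF : IsMeanStd F μ σ) (h : IsSingleCrossing F f) : 0 < σ := by
  refine lt_of_le_of_ne ((Real.sqrt_nonneg _).trans hF.std) fun h0 => ?_
  have h1 := hF.std
  rw [← h0, Real.sqrt_le_left le_rfl, zero_pow two_ne_zero] at h1
  have h2 := ae_eq_integral_of_variance_eq_zero hF.memLp (le_antisymm h1 (variance_nonneg _ _))
  have h3 : ∀ᵐ x ∂F, x ≠ ∫ y, y ∂F := by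
    rw [ae_iff]
    simpa using h.measure_singleton _
  obtain ⟨x, hx, hx'⟩ := (h2.and h3).exists
  exact hx' hx

lemma IsMeanStd.integral_sq_le {F : Measure ℝ} [IsProbabilityMeasure F] {μ σ : ℝ}
    (hF : IsMeanStd F μ σ) (hσ : 0 ≤ σ) : ∫ x, x ^ 2 ∂F ≤ μ ^ 2 + σ ^ 2 := by
  have h1 := (Real.sqrt_le_left hσ).1 hF.std
  have h2 := variance_eq_sub hF.memLp
  rw [hF.mean] at h2
  have h3 : ∫ x, ((fun x : ℝ => x) ^ 2) x ∂F = ∫ x, x ^ 2 ∂F := rfl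
  linarith

lemma logLottery_eq {μ σ : ℝ} (hμ : 0 < μ) (hσ : 0 < σ) : logLottery μ σ =
    (volume.restrict (Set.Icc (logParams μ σ).1 (logParams μ σ).2)).withDensity
      fun x => ENNReal.ofReal (logDensity (logParams μ σ).1 (logParams μ σ).2 x) := by
  rw [logLottery, if_pos ⟨hμ, hσ⟩]

lemma ae_mem_Icc_logLottery {μ σ : ℝ} (hμ : 0 < μ) (hσ : 0 < σ) :
    ∀ᵐ p ∂logLottery μ σ, p ∈ Set.Icc (logParams μ σ).1 (logParams μ σ).2 := by
  rw [logLottery_eq hμ hσ]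
  exact (withDensity_absolutelyContinuous _ _).ae_le (ae_restrict_mem measurableSet_Icc)

lemma logDensity_nonneg {a b x : ℝ} (ha : 0 < a) (hab : a < b) (hx : x ∈ Set.Icc a b) :
    0 ≤ logDensity a b x := by
  have hx0 : 0 < x := ha.trans_le hx.1
  refine div_nonneg ?_ (logNum_pos ha hab).le
  rw [sub_nonneg, le_div_iff₀ hx0]
  linarith [hx.2]

lemma measurable_logDensity (a b : ℝ) : Measurable (logDensity a b) := by
  unfold logDensity
  fun_prop

/-- Price times density is affine in the price. This is what makes the revenue from a fixed value in
the support quadratic in that value. -/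
lemma integral_logLottery_eq {μ σ : ℝ} (hμ : 0 < μ) (hσ : 0 < σ) (g : ℝ → ℝ) :
    ∫ p, p * g p ∂logLottery μ σ =
      (∫ p in Set.Icc (logParams μ σ).1 (logParams μ σ).2, ((logParams μ σ).2 - p) * g p) /
        logNum (logParams μ σ).1 (logParams μ σ).2 (logParams μ σ).2 := by
  rw [logLottery_eq hμ hσ]
  have hlt := logParams_lt hμ hσ
  have h0 := (isLogParams_logParams hμ σ).1
  generalize (logParams μ σ).1 = a at *
  generalize (logParams μ σ).2 = b at *
  rw [integral_withDensity_eq_integral_toReal_smul (measurable_logDensity a b).ennreal_ofReal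
    (Filter.Eventually.of_forall fun _ => ENNReal.ofReal_lt_top), ← integral_div]
  refine setIntegral_congr_fun measurableSet_Icc fun p hp => ?_
  have hp0 : 0 < p := h0.trans_le hp.1
  simp only [smul_eq_mul]
  rw [ENNReal.toReal_ofReal (logDensity_nonneg h0 hlt hp), logDensity]
  field_simp

/-- Equality holds for `v` in `[a, b]`. Below `a` the left side is negative, and above `b` it
decreases while the integral is constant. The quadratic is thus a global minorant, whose mean
involves only two moments. -/
lemma sq_sub_sq_le_setIntegral {a b : ℝ} (hab : a ≤ b) (v : ℝ) :
    ((b - a) ^ 2 - (b - v) ^ 2) / 2 ≤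
      ∫ p in Set.Icc a b, (b - p) * Set.indicator (Set.Iio v) (fun _ => (1 : ℝ)) p := by
  have hcont : Continuous fun p : ℝ => b - p := by fun_prop
  have heq : (fun p => (b - p) * Set.indicator (Set.Iio v) (fun _ => (1 : ℝ)) p)
      = Set.indicator (Set.Iio v) fun p => b - p := by
    funext p
    by_cases hp : p ∈ Set.Iio v <;> simp [hp]
  rw [heq, setIntegral_indicator measurableSet_Iio]
  rcases lt_or_ge v a with hva | hav
  · refine le_trans (b := 0) ?_ (setIntegral_nonneg (measurableSet_Icc.inter measurableSet_Iio)
      fun p hp => sub_nonneg.2 hp.1.2)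
    nlinarith
  · set w := min v b with hw
    have haw : a ≤ w := le_min hav hab
    have hsub : Set.Ioo a w ⊆ Set.Icc a b ∩ Set.Iio v := fun p hp =>
      ⟨⟨hp.1.le, hp.2.le.trans (min_le_right _ _)⟩, hp.2.trans_le (min_le_left _ _)⟩
    have h1 : ∫ p in Set.Ioo a w, (b - p) ≤ ∫ p in Set.Icc a b ∩ Set.Iio v, (b - p) := by
      refine setIntegral_mono_set
        ((hcont.integrableOn_Icc (a := a) (b := b)).mono_set Set.inter_subset_left) ?_
        (LE.le.eventuallyLE hsub)
      filter_upwards [ae_restrict_mem (measurableSet_Icc.inter measurableSet_Iio)] with p hp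
      exact sub_nonneg.2 hp.1.2
    refine le_trans ?_ h1
    rw [← integral_Ioc_eq_integral_Ioo, ← intervalIntegral.integral_of_le haw]
    have h2 : ∫ p in a..w, (b - p) = ((b - a) ^ 2 - (b - w) ^ 2) / 2 := by
      rw [intervalIntegral.integral_sub (by simp) (by simp)]
      simp
      ring
    rw [h2]
    rcases le_total v b with h | h
    · rw [hw, min_eq_left h]
    · rw [hw, min_eq_right h]
      nlinarith [sq_nonneg (b - v)]

/-- The log-lottery extracts at least `π₁` in expectation. -/
lemma fst_le_integral_priceRevenue {F : Measure ℝ} [IsProbabilityMeasure F] {μ σ : ℝ}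
    (hμ : 0 < μ) (hσ : 0 < σ) (hF : IsMeanStd F μ σ) :
    (logParams μ σ).1 ≤ ∫ p, priceRevenue F p ∂logLottery μ σ := by
  have hsupp := ae_mem_Icc_logLottery hμ hσ
  have h0 := (isLogParams_logParams hμ σ).1
  have hlt := logParams_lt hμ hσ
  have hK := logNum_pos h0 hlt
  have hsys := (isLogParams_logParams hμ σ).2.2
  have hinner : ∀ v, ((((logParams μ σ).2 - (logParams μ σ).1) ^ 2
      - ((logParams μ σ).2 - v) ^ 2) / 2)
      / logNum (logParams μ σ).1 (logParams μ σ).2 (logParams μ σ).2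
      ≤ ∫ p, p * Set.indicator (Set.Iio v) (fun _ => (1 : ℝ)) p ∂logLottery μ σ := fun v => by
    rw [integral_logLottery_eq hμ hσ]
    exact div_le_div_of_nonneg_right (sq_sub_sq_le_setIntegral hlt.le v) hK.le
  generalize (logParams μ σ).1 = a at *
  generalize (logParams μ σ).2 = b at *
  set P := logLottery μ σ
  have hmeas : Measurable fun q : ℝ × ℝ => q.2 * Set.indicator {q : ℝ × ℝ | q.2 < q.1}
      (fun _ => (1 : ℝ)) q :=
    measurable_snd.mul (measurable_const.indicator (measurableSet_lt measurable_snd measurable_fst))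
  have hprod : Integrable (fun q : ℝ × ℝ => q.2 * Set.indicator {q : ℝ × ℝ | q.2 < q.1}
      (fun _ => (1 : ℝ)) q) (F.prod P) := by
    have hsupp' : ∀ᵐ q ∂F.prod P, q.2 ∈ Set.Icc a b :=
      Measure.quasiMeasurePreserving_snd.ae hsupp
    refine Integrable.of_bound hmeas.aestronglyMeasurable b ?_
    filter_upwards [hsupp'] with q hq
    have hq0 : 0 ≤ q.2 := h0.le.trans hq.1
    rw [norm_mul, Real.norm_of_nonneg hq0]
    refine (mul_le_of_le_one_right hq0 ?_).trans hq.2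
    by_cases hmem : q ∈ {q : ℝ × ℝ | q.2 < q.1} <;> simp [hmem]
  have hind : ∀ v p : ℝ, Set.indicator {q : ℝ × ℝ | q.2 < q.1} (fun _ => (1 : ℝ)) (v, p)
      = Set.indicator (Set.Iio v) (fun _ => (1 : ℝ)) p := fun v p => by
    simp [Set.indicator_apply]
  have hind2 : ∀ v p : ℝ, Set.indicator {q : ℝ × ℝ | q.2 < q.1} (fun _ => (1 : ℝ)) (v, p)
      = Set.indicator (Set.Ioi p) (fun _ => (1 : ℝ)) v := fun v p => by
    simp [Set.indicator_apply]
  have hswap := integral_integral_swap (μ := F) (ν := P) (f := fun v p => p *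
    Set.indicator {q : ℝ × ℝ | q.2 < q.1} (fun _ => (1 : ℝ)) (v, p)) hprod
  have hR : ∫ p, priceRevenue F p ∂P = ∫ v, (∫ p, p *
      Set.indicator (Set.Iio v) (fun _ => (1 : ℝ)) p ∂P) ∂F := by
    simp_rw [← hind]
    rw [hswap]
    congr 1
    funext p
    simp_rw [hind2, integral_const_mul]
    rw [integral_indicator measurableSet_Ioi]
    simp [priceRevenue]
  have hint1 : Integrable (fun x : ℝ => x) F := hF.memLp.integrable (by norm_num)
  have hint2 : Integrable (fun x : ℝ => x ^ 2) F := hF.memLp.integrable_sq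
  have hquad : (fun v : ℝ => ((b - a) ^ 2 - (b - v) ^ 2) / 2 / logNum a b b)
      = fun v => (logNum a b b)⁻¹ * ((a ^ 2 - 2 * a * b) / 2 + (b * v - v ^ 2 / 2)) := by
    funext v
    field_simp
    ring
  have hlin : Integrable (fun v : ℝ => b * v - v ^ 2 / 2) F :=
    (hint1.const_mul b).sub (hint2.div_const 2)
  have hquadint : Integrable (fun v : ℝ => ((b - a) ^ 2 - (b - v) ^ 2) / 2 / logNum a b b) F := by
    rw [hquad]
    exact ((integrable_const _).add hlin).const_mul _
  have hquadval : ∫ v, ((b - a) ^ 2 - (b - v) ^ 2) / 2 / logNum a b b ∂F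
      = (logNum a b b)⁻¹ * ((a ^ 2 - 2 * a * b) / 2 + (b * μ - (∫ v, v ^ 2 ∂F) / 2)) := by
    have hdiv : ∫ v, v ^ 2 / 2 ∂F = (∫ v, v ^ 2 ∂F) / 2 := integral_div _ _
    rw [hquad, integral_const_mul, integral_add (integrable_const _) hlin,
      integral_sub (hint1.const_mul b) (hint2.div_const 2), integral_const_mul, hdiv,
      hF.mean]
    simp
  have hmono := integral_mono hquadint ((Integrable.integral_prod_left hprod).congr
    (Filter.Eventually.of_forall fun v => by simp_rw [hind])) hinner
  rw [hR]
  refine le_trans ?_ hmono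
  rw [hquadval, inv_mul_eq_div, le_div_iff₀ hK]
  have hsq := hF.integral_sq_le hσ.le
  -- The first equation of the system enters here. What remains is that the second moment is at most
  -- `2ab - a²`, which is the second equation.
  have hlog : a * logNum a b b = b * μ - 2 * a * b + a ^ 2 := by
    have := hsys.1
    unfold logNum
    linear_combination b * this
  rw [hlog]
  linarith [hsys.2]

/-! ### One bidder: lottery against threshold, and Myerson's bound -/

section SingleBidder

lemma integrable_of_bounds {P : Measure ℝ} [IsProbabilityMeasure P] {g : ℝ → ℝ} {c : ℝ}
    (hg : Measurable g) (h : ∀ᵐ p ∂P, 0 ≤ g p ∧ g p ≤ c) : Integrable g P := by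
  refine Integrable.of_bound hg.aestronglyMeasurable c ?_
  filter_upwards [h] with p hp
  rw [Real.norm_of_nonneg hp.1]
  exact hp.2

lemma measurable_setIntegral_Ioi {F : Measure ℝ} {f : ℝ → ℝ} (h : IsSingleCrossing F f) :
    Measurable fun x => ∫ y in Set.Ioi x, y ∂F := by
  refine Antitone.measurable fun a b hab => ?_
  exact setIntegral_mono_set h.integrable.integrableOn (ae_restrict_of_ae h.ae_nonneg)
    (LE.le.eventuallyLE (Set.Ioi_subset_Ioi hab))

variable {F : Measure ℝ} [IsProbabilityMeasure F] {f : ℝ → ℝ} {μ σ : ℝ}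

lemma ae_nonneg_logLottery (hμ : 0 < μ) (hσ : 0 < σ) : ∀ᵐ p ∂logLottery μ σ, 0 ≤ p := by
  filter_upwards [ae_mem_Icc_logLottery hμ hσ] with p hp
  exact (isLogParams_logParams hμ σ).1.le.trans hp.1

lemma integrable_priceRevenue_logLottery (h : IsSingleCrossing F f) (hμ : 0 < μ) (hσ : 0 < σ) :
    Integrable (priceRevenue F) (logLottery μ σ) := by
  refine integrable_of_bounds (measurable_priceRevenue F) (c := ∫ y, y ∂F) ?_
  filter_upwards [ae_nonneg_logLottery hμ hσ] with p hp
  exact ⟨priceRevenue_nonneg F hp, h.priceRevenue_le_mean p⟩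

/-- The log-lottery, offered on top of a threshold `t`, earns a `1 / ρ` fraction of the revenue of
every price above `t`. -/
lemma priceRevenue_le_rho_mul (h : IsSingleCrossing F f) (hμ : 0 < μ) (hF : IsMeanStd F μ σ)
    {t x : ℝ} (ht : 0 ≤ t) (hx : t ≤ x) :
    priceRevenue F x ≤
      rho (σ / μ) * ∫ p, priceRevenue F (max t p) ∂logLottery μ σ := by
  have hσ := hF.std_pos h
  have hρ := (isRho_rho (σ / μ)).1
  have h1 := fst_le_integral_priceRevenue hμ hσ hF
  rw [logParams_fst hμ] at h1
  have h2 : (∫ p, priceRevenue F p ∂logLottery μ σ) * priceRevenue F x ≤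
      (∫ p, priceRevenue F (max t p) ∂logLottery μ σ) * ∫ y, y ∂F := by
    rw [← integral_mul_const, ← integral_mul_const]
    refine integral_mono_ae ((integrable_priceRevenue_logLottery h hμ hσ).mul_const _)
      (Integrable.mul_const ?_ _) ?_
    · refine integrable_of_bounds
        ((measurable_priceRevenue F).comp (measurable_const.max measurable_id)) (c := ∫ y, y ∂F) ?_
      exact Filter.Eventually.of_forall fun p =>
        ⟨priceRevenue_nonneg F (ht.trans (le_max_left _ _)), h.priceRevenue_le_mean _⟩
    · filter_upwards [ae_nonneg_logLottery hμ hσ] with p hp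
      exact h.priceRevenue_mul_le hp ht hx
  rw [hF.mean] at h2
  have h3 := mul_le_mul_of_nonneg_right h1 (priceRevenue_nonneg F (ht.trans hx))
  have h4 := h3.trans h2
  rw [div_mul_eq_mul_div, div_le_iff₀ hρ] at h4
  refine le_of_mul_le_mul_left ?_ hμ
  linarith

/-- Welfare analogue of `priceRevenue_le_rho_mul`: the truncated mean dominates the revenue, so the
lottery guarantee carries over. -/
lemma setIntegral_le_rho_mul (h : IsSingleCrossing F f) (hμ : 0 < μ) (hF : IsMeanStd F μ σ)
    (t : ℝ) :
    ∫ y in Set.Ioi t, y ∂F ≤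
      rho (σ / μ) * ∫ p, (∫ y in Set.Ioi (max t p), y ∂F) ∂logLottery μ σ := by
  have hσ := hF.std_pos h
  have hρ := (isRho_rho (σ / μ)).1
  have h1 := fst_le_integral_priceRevenue hμ hσ hF
  rw [logParams_fst hμ] at h1
  have hint : Integrable (fun p => ∫ y in Set.Ioi p, y ∂F) (logLottery μ σ) :=
    integrable_of_bounds (measurable_setIntegral_Ioi h) (Filter.Eventually.of_forall fun p =>
      ⟨h.setIntegral_nonneg p, h.setIntegral_le_integral p⟩)
  have h0 : ∫ p, priceRevenue F p ∂logLottery μ σ ≤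
      ∫ p, (∫ y in Set.Ioi p, y ∂F) ∂logLottery μ σ :=
    integral_mono (integrable_priceRevenue_logLottery h hμ hσ) hint
      h.priceRevenue_le_setIntegral
  have h2 : (∫ p, (∫ y in Set.Ioi p, y ∂F) ∂logLottery μ σ) * ∫ y in Set.Ioi t, y ∂F ≤
      (∫ p, (∫ y in Set.Ioi (max t p), y ∂F) ∂logLottery μ σ) * ∫ y, y ∂F := by
    rw [← integral_mul_const, ← integral_mul_const]
    refine integral_mono (hint.mul_const _) (Integrable.mul_const ?_ _) ?_
    · exact integrable_of_bounds
        ((measurable_setIntegral_Ioi h).comp (measurable_const.max measurable_id))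
        (Filter.Eventually.of_forall fun p =>
          ⟨h.setIntegral_nonneg _, h.setIntegral_le_integral _⟩)
    · exact fun p => h.setIntegral_mul_le t p
  rw [hF.mean] at h2
  have h3 := mul_le_mul_of_nonneg_right (h1.trans h0) (h.setIntegral_nonneg t)
  have h4 := h3.trans h2
  rw [div_mul_eq_mul_div, div_le_iff₀ hρ] at h4
  refine le_of_mul_le_mul_left ?_ hμ
  linarith

/-- The source of the factor 2: the virtual part is at most the revenue of some price above `t`, the
payment part is the revenue of `t` itself, and each is compared with the lottery. -/
lemma virtual_surplus_le_rho_mul (h : IsSingleCrossing F f) (hμ : 0 < μ) (hF : IsMeanStd F μ σ)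
    {t : ℝ} (ht : 0 ≤ t) :
    ∫ y in Set.Ioi t, (max (virtualValue F f y) 0 + t) ∂F ≤
      2 * rho (σ / μ) * ∫ p, priceRevenue F (max t p) ∂logLottery μ σ := by
  obtain ⟨x, hx, hle⟩ := h.exists_setIntegral_max_le ht
  rw [integral_add h.integrable_virtualValue.pos_part.integrableOn (integrable_const _)]
  have h1 := priceRevenue_le_rho_mul h hμ hF ht hx
  have h2 := priceRevenue_le_rho_mul h hμ hF ht le_rfl
  have h3 : ∫ _ in Set.Ioi t, t ∂F = priceRevenue F t := by
    simp [priceRevenue, mul_comm]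
  rw [h3]
  linarith

/-- Envelope inequality. -/
lemma primitive_le_of_subgradient {X U : ℝ → ℝ} (hX : Monotone X) (h1 : ∀ x, X x ≤ 1)
    (h0 : ∀ x, 0 ≤ X x) (hU0 : 0 ≤ U 0)
    (hU : ∀ a b, 0 ≤ a → a ≤ b → (b - a) * X a ≤ U b - U a) {y : ℝ} (hy : 0 ≤ y) :
    ∫ t in (0 : ℝ)..y, X t ≤ U y := by
  have hII : ∀ a b, IntervalIntegrable X volume a b := fun a b => hX.intervalIntegrable
  set D : ℝ → ℝ := fun b => (∫ t in (0 : ℝ)..b, X t) - U b with hD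
  have hstep : ∀ a b, 0 ≤ a → a ≤ b → D b - D a ≤ (b - a) * (X b - X a) := by
    intro a b ha hab
    have h2 : (∫ t in (0 : ℝ)..b, X t) - ∫ t in (0 : ℝ)..a, X t = ∫ t in a..b, X t :=
      intervalIntegral.integral_interval_sub_left (hII _ _) (hII _ _)
    have h3 : ∫ t in a..b, X t ≤ ∫ _ in a..b, X b :=
      intervalIntegral.integral_mono_on hab (hII _ _) intervalIntegrable_const
        fun u hu => hX hu.2
    rw [intervalIntegral.integral_const, smul_eq_mul] at h3
    have h4 := hU a b ha hab
    simp only [hD]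
    linarith
  -- On `N + 1` equal pieces the errors telescope to the step length times the total increase of
  -- `X`, which is at most `1`.
  have hN : ∀ N : ℕ, D y - D 0 ≤ y / (N + 1) := by
    intro N
    have hN0 : (0 : ℝ) < N + 1 := by positivity
    set p : ℕ → ℝ := fun k => k * (y / (N + 1)) with hp
    have hpk : ∀ k, p (k + 1) - p k = y / (N + 1) := fun k => by
      simp only [hp]
      push_cast
      ring
    have hyN : 0 ≤ y / (N + 1) := by positivity
    have hpN : p (N + 1) = y := by
      simp only [hp]
      push_cast
      field_simp
    have hp0 : p 0 = 0 := by simp [hp]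
    have hsum : ∑ k ∈ Finset.range (N + 1), (D (p (k + 1)) - D (p k)) ≤
        ∑ k ∈ Finset.range (N + 1), y / (N + 1) * (X (p (k + 1)) - X (p k)) := by
      refine Finset.sum_le_sum fun k _ => ?_
      rw [← hpk k]
      refine hstep _ _ (by positivity) ?_
      have := hpk k
      linarith
    rw [Finset.sum_range_sub (fun k => D (p k)), ← Finset.mul_sum,
      Finset.sum_range_sub (fun k => X (p k)), hpN, hp0] at hsum
    refine hsum.trans (mul_le_of_le_one_right hyN ?_)
    linarith [h1 y, h0 0]
  have hlim : Filter.Tendsto (fun N : ℕ => y / ((N : ℝ) + 1)) Filter.atTop (nhds 0) :=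
    tendsto_const_div_atTop_nhds_zero_nat y |>.comp (Filter.tendsto_add_atTop_nat 1) |>.congr
      fun N => by simp
  have hle : D y - D 0 ≤ 0 := ge_of_tendsto' hlim hN
  have hD0 : D 0 = - U 0 := by simp [hD]
  simp only [hD0] at hle
  simp only [hD] at hle
  linarith

/-- Myerson's bound: truthful interim payments are at most the expected virtual surplus. -/
lemma integral_pay_le_virtual (h : IsSingleCrossing F f) {X P : ℝ → ℝ}
    (hX : ∀ x, 0 ≤ x → X x ∈ Set.Icc 0 1) (hP : Integrable P F)
    (hIC : ∀ t, 0 ≤ t → ∀ b, 0 ≤ b → t * X b - P b ≤ t * X t - P t)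
    (hIR : ∀ t, 0 ≤ t → 0 ≤ t * X t - P t) :
    ∫ y, P y ∂F ≤ ∫ y, virtualValue F f y * X y ∂F := by
  have hmono : ∀ a b, 0 ≤ a → a ≤ b → X a ≤ X b := by
    intro a b ha hab
    rcases hab.eq_or_lt with rfl | hlt
    · exact le_rfl
    have h1 := hIC a ha b (ha.trans hab)
    have h2 := hIC b (ha.trans hab) a ha
    have h3 : 0 ≤ (b - a) * (X b - X a) := by linarith
    linarith [nonneg_of_mul_nonneg_right h3 (sub_pos.2 hlt)]
  -- Incentive compatibility makes `X` monotone only for nonnegative types; the constant extension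
  -- to the left is monotone everywhere.
  set Y : ℝ → ℝ := fun x => X (max 0 x) with hY
  have hYX : ∀ x, 0 ≤ x → Y x = X x := fun x hx => by simp only [hY, max_eq_right hx]
  have hYm : Monotone Y := fun a b hab =>
    hmono _ _ (le_max_left _ _) (max_le_max_left 0 hab)
  have hY0 : ∀ x, 0 ≤ Y x := fun x => (hX _ (le_max_left _ _)).1
  have hY1 : ∀ x, Y x ≤ 1 := fun x => (hX _ (le_max_left _ _)).2
  obtain ⟨hHI, hSI, hHeq⟩ := integral_primitive_eq h.ae_nonneg h.integrable hYm hY0 hY1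
  have hHU : ∀ y, 0 ≤ y → ∫ t in (0 : ℝ)..y, Y t ≤ y * X y - P y := by
    intro y hy
    refine primitive_le_of_subgradient (U := fun y => y * X y - P y) hYm hY1 hY0
      (hIR 0 le_rfl) (fun a b ha hab => ?_) hy
    have := hIC b (ha.trans hab) a ha
    rw [hYX a ha]
    linarith
  have hbdd : ∀ {g : ℝ → ℝ}, Integrable g F → Integrable (fun y => g y * Y y) F := by
    intro g hg
    refine hg.mul_bdd (c := 1) hYm.measurable.aestronglyMeasurable
      (Filter.Eventually.of_forall fun y => ?_)
    rw [Real.norm_of_nonneg (hY0 y)]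
    exact hY1 y
  have hSf : Integrable (fun y => F.real (Set.Ioi y) / f y) F :=
    (h.integrable.sub h.integrable_virtualValue).congr
      (Filter.Eventually.of_forall fun y => by simp [virtualValue])
  have h1 : ∫ y, P y ∂F ≤ ∫ y, (y * Y y - ∫ t in (0 : ℝ)..y, Y t) ∂F := by
    refine integral_mono_ae hP ((hbdd h.integrable).sub hHI) ?_
    filter_upwards [h.ae_nonneg] with y hy
    simp only [hYX y hy]
    linarith [hHU y hy]
  -- An inequality suffices: where `f` vanishes the left integrand is lost, elsewhere the density
  -- cancels.
  have h2 : ∫ y, F.real (Set.Ioi y) / f y * Y y ∂F ≤ ∫ y, (∫ t in (0 : ℝ)..y, Y t) ∂F := by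
    have hres : ∫ y, F.real (Set.Ioi y) / f y * Y y ∂F
        = ∫ y in Set.Ioi 0, F.real (Set.Ioi y) / f y * Y y ∂F := by
      rw [← integral_indicator measurableSet_Ioi]
      refine integral_congr_ae ?_
      filter_upwards [h.ae_pos] with y hy
      rw [Set.indicator_of_mem (Set.mem_Ioi.2 hy)]
    rw [hHeq, hres, h.setIntegral_eq _ measurableSet_Ioi]
    refine integral_mono ((h.integrable_iff.1 (hbdd hSf)).integrableOn) hSI fun y => ?_
    rcases (h.nonneg y).eq_or_lt with h0 | h0
    · simp only [← h0, zero_mul]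
      exact mul_nonneg measureReal_nonneg (hY0 y)
    · refine le_of_eq ?_
      simp only
      field_simp
  rw [integral_sub (hbdd h.integrable) hHI] at h1
  have h3 : ∫ y, virtualValue F f y * X y ∂F
      = ∫ y, y * Y y ∂F - ∫ y, F.real (Set.Ioi y) / f y * Y y ∂F := by
    rw [← integral_sub (hbdd h.integrable) (hbdd hSf)]
    refine integral_congr_ae ?_
    filter_upwards [h.ae_nonneg] with y hy
    rw [hYX y hy, virtualValue]
    ring
  rw [h3]
  linarith

end SingleBidder

/-! ### Resampling one coordinate of a product measure -/

section Product

variable {n : ℕ} (F : Fin n → Measure ℝ) [∀ i, IsProbabilityMeasure (F i)]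

lemma measurable_update_prod (i : Fin n) :
    Measurable fun q : (Fin n → ℝ) × ℝ => Function.update q.1 i q.2 :=
  measurable_pi_lambda _ fun j => by
    by_cases hj : j = i
    · subst hj
      simpa using measurable_snd
    · simp only [Function.update_of_ne hj]
      exact (measurable_pi_apply j).comp measurable_fst

/-- Resampling one coordinate preserves a product measure. -/
lemma measurePreserving_update (i : Fin n) :
    MeasurePreserving (fun q : (Fin n → ℝ) × ℝ => Function.update q.1 i q.2)
      ((Measure.pi F).prod (F i)) (Measure.pi F) := by
  refine ⟨measurable_update_prod i, (Measure.pi_eq fun s hs => ?_).symm⟩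
  rw [Measure.map_apply (measurable_update_prod i) (MeasurableSet.univ_pi hs)]
  have hpre : (fun q : (Fin n → ℝ) × ℝ => Function.update q.1 i q.2) ⁻¹' Set.univ.pi s
      = (Set.univ.pi (Function.update s i Set.univ)) ×ˢ s i := by
    ext q
    simp only [Set.mem_preimage, Set.mem_pi, Set.mem_univ, true_imp_iff, Set.mem_prod]
    constructor
    · intro h
      refine ⟨fun j => ?_, by simpa using h i⟩
      by_cases hj : j = i
      · subst hj; simp
      · simpa [Function.update_of_ne hj] using h j
    · rintro ⟨h1, h2⟩ j
      by_cases hj : j = i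
      · subst hj; simpa using h2
      · simpa [Function.update_of_ne hj] using h1 j
  rw [hpre, Measure.prod_prod, Measure.pi_pi, ← Finset.mul_prod_erase _ _ (Finset.mem_univ i),
    ← Finset.mul_prod_erase _ (fun j => F j (s j)) (Finset.mem_univ i)]
  simp only [Function.update_self, measure_univ, one_mul]
  rw [mul_comm]
  congr 1
  refine Finset.prod_congr rfl fun j hj => ?_
  rw [Function.update_of_ne (Finset.ne_of_mem_erase hj)]

lemma integrable_update (i : Fin n) {h : (Fin n → ℝ) → ℝ} (hh : Integrable h (Measure.pi F)) :
    Integrable (fun q : (Fin n → ℝ) × ℝ => h (Function.update q.1 i q.2))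
      ((Measure.pi F).prod (F i)) :=
  (measurePreserving_update F i).integrable_comp_of_integrable hh

lemma integral_update (i : Fin n) {h : (Fin n → ℝ) → ℝ} (hh : Integrable h (Measure.pi F)) :
    ∫ v, h v ∂Measure.pi F
      = ∫ v, (∫ y, h (Function.update v i y) ∂F i) ∂Measure.pi F := by
  have hm := measurePreserving_update F i
  rw [← integral_prod _ (integrable_update F i hh)]
  conv_lhs => rw [← hm.map_eq]
  rw [integral_map hm.aemeasurable (by rw [hm.map_eq]; exact hh.aestronglyMeasurable)]

lemma integral_update' (i : Fin n) {h : (Fin n → ℝ) → ℝ} (hh : Integrable h (Measure.pi F)) :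
    ∫ v, h v ∂Measure.pi F
      = ∫ y, (∫ v, h (Function.update v i y) ∂Measure.pi F) ∂F i := by
  rw [integral_update F i hh]
  exact integral_integral_swap (f := fun v y => h (Function.update v i y))
    (integrable_update F i hh)

variable {F}

lemma ae_pi_of_ae {p : Fin n → ℝ → Prop} (h : ∀ i, ∀ᵐ y ∂F i, p i y) :
    ∀ᵐ v ∂Measure.pi F, ∀ i, p i (v i) :=
  ae_all_iff.2 fun i => (measurePreserving_eval F i).quasiMeasurePreserving.ae (h i)

/-- Given the other coordinates, `τ` is constant while coordinate `i` has no atoms. -/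
lemma ae_ne_of_update (i : Fin n) (h0 : ∀ x, F i {x} = 0) {τ : (Fin n → ℝ) → ℝ}
    (hτ : Measurable τ) (hτu : ∀ v y, τ (Function.update v i y) = τ v) :
    ∀ᵐ v ∂Measure.pi F, τ v ≠ v i := by
  have hm := measurePreserving_update F i
  rw [← hm.map_eq, ae_map_iff hm.aemeasurable]
  · rw [Measure.ae_prod_iff_ae_ae]
    · refine Filter.Eventually.of_forall fun v => ?_
      rw [ae_iff]
      simp only [hτu, Function.update_self, ne_eq, not_not]
      have : {a | τ v = a} = {τ v} := by ext a; simp [eq_comm]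
      rw [this, h0]
    · exact (measurableSet_eq_fun (hτ.comp hm.measurable)
        ((measurable_pi_apply i).comp hm.measurable)).compl
  · exact (measurableSet_eq_fun hτ (measurable_pi_apply i)).compl

end Product

/-! ### Expected outcome of a threshold offer -/

section Offers

variable {n : ℕ} {F : Fin n → Measure ℝ} [∀ i, IsProbabilityMeasure (F i)]

lemma integrable_comp_eval (i : Fin n) {c : ℝ → ℝ} (hc : Integrable c (F i)) :
    Integrable (fun v : Fin n → ℝ => c (v i)) (Measure.pi F) :=
  (measurePreserving_eval F i).integrable_comp_of_integrable hc

/-- Integration over the value of bidder `i` above a threshold set by the others. -/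
lemma integral_threshold_indicator (i : Fin n) {τ : (Fin n → ℝ) → ℝ} (hτ : Measurable τ)
    (hτu : ∀ v y, τ (Function.update v i y) = τ v) (hτ0 : ∀ v, 0 ≤ τ v) {c : ℝ → ℝ}
    (hc : Integrable c (F i)) (hc0 : ∀ y, 0 ≤ c y) {g : ℝ → ℝ → ℝ}
    (hg : Measurable (Function.uncurry g))
    (hb : ∀ t y, 0 ≤ t → t ≤ y → |g t y| ≤ c y) :
    Integrable (Set.indicator {v | τ v ≤ v i} fun v => g (τ v) (v i)) (Measure.pi F) ∧
    Integrable (fun v => ∫ y in Set.Ici (τ v), g (τ v) y ∂F i) (Measure.pi F) ∧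
    ∫ v, Set.indicator {v | τ v ≤ v i} (fun v => g (τ v) (v i)) v ∂Measure.pi F
      = ∫ v, (∫ y in Set.Ici (τ v), g (τ v) y ∂F i) ∂Measure.pi F := by
  have hmeas : Measurable (Set.indicator {v | τ v ≤ v i} fun v => g (τ v) (v i)) :=
    (hg.comp (hτ.prodMk (measurable_pi_apply i))).indicator
      (measurableSet_le hτ (measurable_pi_apply i))
  have hI : Integrable (Set.indicator {v | τ v ≤ v i} fun v => g (τ v) (v i))
      (Measure.pi F) := by
    refine (integrable_comp_eval i hc).mono' hmeas.aestronglyMeasurable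
      (Filter.Eventually.of_forall fun v => ?_)
    by_cases hv : τ v ≤ v i
    · rw [Set.indicator_of_mem (by exact hv), Real.norm_eq_abs]
      exact hb _ _ (hτ0 v) hv
    · rw [Set.indicator_of_notMem (by exact hv), norm_zero]
      exact hc0 _
  have hupd : ∀ v y, Set.indicator {v | τ v ≤ v i} (fun v => g (τ v) (v i))
      (Function.update v i y) = Set.indicator (Set.Ici (τ v)) (fun y => g (τ v) y) y := by
    intro v y
    simp [Set.indicator_apply, hτu]
  refine ⟨hI, ?_, ?_⟩
  · refine (integrable_update F i hI).integral_prod_left.congr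
      (Filter.Eventually.of_forall fun v => ?_)
    simp only [hupd]
    rw [integral_indicator measurableSet_Ici]
  · rw [integral_update F i hI]
    simp only [hupd]
    simp_rw [integral_indicator measurableSet_Ici]

/-- Integration over the value of bidder `i`, who faces a threshold set by the others and an
independent reserve. -/
lemma integral_offer_indicator {P : Fin n → Measure ℝ} [∀ i, IsProbabilityMeasure (P i)]
    (i : Fin n) {τ : (Fin n → ℝ) → ℝ} (hτ : Measurable τ)
    (hτu : ∀ v y, τ (Function.update v i y) = τ v) (hτ0 : ∀ v, 0 ≤ τ v)
    (hc : Integrable (fun y => y) (F i)) {g : ℝ → ℝ → ℝ}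
    (hg : Measurable (Function.uncurry g))
    (hb : ∀ t y, 0 ≤ t → t ≤ y → |g t y| ≤ |y|) {J : ℝ → ℝ} (hJm : Measurable J) {C : ℝ}
    (hJC : ∀ x, 0 ≤ x → |J x| ≤ C) (hJ : ∀ x, ∫ y in Set.Ici x, g x y ∂F i = J x) :
    Integrable (Set.indicator {q : (Fin n → ℝ) × (Fin n → ℝ) | max (τ q.1) (q.2 i) ≤ q.1 i}
      fun q => g (max (τ q.1) (q.2 i)) (q.1 i)) ((Measure.pi F).prod (Measure.pi P)) ∧
    Integrable (fun v => ∫ p, J (max (τ v) p) ∂P i) (Measure.pi F) ∧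
    ∫ q, Set.indicator {q : (Fin n → ℝ) × (Fin n → ℝ) | max (τ q.1) (q.2 i) ≤ q.1 i}
      (fun q => g (max (τ q.1) (q.2 i)) (q.1 i)) q ∂(Measure.pi F).prod (Measure.pi P)
      = ∫ v, (∫ p, J (max (τ v) p) ∂P i) ∂Measure.pi F := by
  have hmax : Measurable fun q : (Fin n → ℝ) × (Fin n → ℝ) => max (τ q.1) (q.2 i) :=
    (hτ.comp measurable_fst).max ((measurable_pi_apply i).comp measurable_snd)
  have hv : Measurable fun q : (Fin n → ℝ) × (Fin n → ℝ) => q.1 i :=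
    (measurable_pi_apply i).comp measurable_fst
  set k := Set.indicator {q : (Fin n → ℝ) × (Fin n → ℝ) | max (τ q.1) (q.2 i) ≤ q.1 i}
      fun q => g (max (τ q.1) (q.2 i)) (q.1 i) with hk
  have hkm : Measurable k := (hg.comp (hmax.prodMk hv)).indicator (measurableSet_le hmax hv)
  have hI : Integrable k ((Measure.pi F).prod (Measure.pi P)) := by
    refine ((integrable_comp_eval i hc.abs).comp_fst (Measure.pi P)).mono'
      hkm.aestronglyMeasurable (Filter.Eventually.of_forall fun q => ?_)
    by_cases hq : max (τ q.1) (q.2 i) ≤ q.1 i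
    · rw [hk, Set.indicator_of_mem (by exact hq), Real.norm_eq_abs]
      exact hb _ _ ((hτ0 _).trans (le_max_left _ _)) hq
    · rw [hk, Set.indicator_of_notMem (by exact hq), norm_zero]
      exact abs_nonneg _
  have hJI : Integrable (fun q : (Fin n → ℝ) × (Fin n → ℝ) => J (max (τ q.1) (q.2 i)))
      ((Measure.pi F).prod (Measure.pi P)) :=
    Integrable.of_bound (hJm.comp hmax).aestronglyMeasurable C
      (Filter.Eventually.of_forall fun q => hJC _ ((hτ0 _).trans (le_max_left _ _)))
  have heval : ∀ v, ∫ p, J (max (τ v) (p i)) ∂Measure.pi P = ∫ p, J (max (τ v) p) ∂P i := by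
    intro v
    have hm := measurePreserving_eval P i
    conv_rhs => rw [← hm.map_eq]
    have hJv : Measurable fun p => J (max (τ v) p) := hJm.comp (measurable_const.max measurable_id)
    rw [integral_map hm.aemeasurable hJv.aestronglyMeasurable]
  refine ⟨hI, ?_, ?_⟩
  · exact hJI.integral_prod_left.congr (Filter.Eventually.of_forall heval)
  -- With the reserves fixed first, the maximum of `τ` and the reserve is again a threshold
  -- independent of coordinate `i`.
  · rw [integral_prod_symm _ hI]
    have hfix : ∀ p : Fin n → ℝ, ∫ v, k (v, p) ∂Measure.pi F
        = ∫ v, J (max (τ v) (p i)) ∂Measure.pi F := by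
      intro p
      have h := (integral_threshold_indicator i (τ := fun v => max (τ v) (p i))
        (hτ.max measurable_const) (fun v y => by rw [hτu])
        (fun v => (hτ0 v).trans (le_max_left _ _)) hc.abs (fun y => abs_nonneg y) hg hb).2.2
      simp only [hJ] at h
      exact h
    simp only [hfix]
    rw [integral_integral_swap (f := fun (p : Fin n → ℝ) v => J (max (τ v) (p i))) hJI.swap]
    simp only [heval]

end Offers

/-! ### From the mechanism to single bidders -/

section Main

lemma setIntegral_Ici_eq {n : ℕ} {F : Fin n → Measure ℝ} {f : Fin n → ℝ → ℝ}
    (hf : ∀ i, IsSingleCrossing (F i) (f i)) (i : Fin n) (x : ℝ) (g : ℝ → ℝ) :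
    ∫ y in Set.Ici x, g y ∂F i = ∫ y in Set.Ioi x, g y ∂F i :=
  setIntegral_congr_set ((hf i).Ici_ae_eq_Ioi x)

variable {n : ℕ} {M : Matroid (Fin n)} {F : Fin n → Measure ℝ} [∀ i, IsProbabilityMeasure (F i)]
  {f : Fin n → ℝ → ℝ} {W : (Fin n → ℝ) → Finset (Fin n)}

open Classical in
/-- The bidders that can be served at all. -/
def nonloops (M : Matroid (Fin n)) : Finset (Fin n) :=
  Finset.univ.filter fun i => M.Indep {i}

/-- Off this null set ties are irrelevant: `W` agrees with a measurable threshold rule, so no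
measurability of `W` itself is needed. -/
lemma ae_pos_and_threshold_ne (hf : ∀ i, IsSingleCrossing (F i) (f i)) :
    ∀ᵐ v ∂Measure.pi F, (∀ i, 0 < v i) ∧ ∀ i, threshold M i v ≠ v i := by
  have h1 : ∀ᵐ v ∂Measure.pi F, ∀ i, 0 < v i :=
    ae_pi_of_ae (p := fun _ y => 0 < y) fun i => (hf i).ae_pos
  have h2 : ∀ᵐ v ∂Measure.pi F, ∀ i, threshold M i v ≠ v i := ae_all_iff.2 fun i =>
    ae_ne_of_update i (hf i).measure_singleton (measurable_threshold M i) (threshold_update M i)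
  exact h1.and h2

lemma IsVCGRule.mem_iff (hW : IsVCGRule M W) {v : Fin n → ℝ} (hv : ∀ i, 0 < v i)
    (hne : ∀ i, threshold M i v ≠ v i) (i : Fin n) :
    i ∈ W v ↔ M.Indep {i} ∧ threshold M i v ≤ v i := by
  have hv0 : ∀ i, 0 ≤ v i := fun i => (hv i).le
  exact ⟨fun h => ⟨hW.indep_singleton hv0 h, hW.threshold_le hv0 h⟩,
    fun h => hW.mem_of_threshold_lt hv0 h.1 (lt_of_le_of_ne h.2 (hne i))⟩

lemma IsVCGRule.sum_eq (hW : IsVCGRule M W) {v : Fin n → ℝ} (hv : ∀ i, 0 < v i)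
    (hne : ∀ i, threshold M i v ≠ v i) (a : Fin n → (Fin n → ℝ) → ℝ) :
    ∑ i ∈ W v, a i v
      = ∑ i ∈ nonloops M, Set.indicator {v | threshold M i v ≤ v i} (a i) v := by
  classical
  have : W v = (nonloops M).filter fun i => threshold M i v ≤ v i := by
    ext i
    simp [hW.mem_iff hv hne, nonloops]
  rw [this, Finset.sum_filter]
  exact Finset.sum_congr rfl fun i _ => by simp [Set.indicator_apply]

lemma lazyWins_iff (hW : IsVCGRule M W) {v p : Fin n → ℝ} (hv : ∀ i, 0 < v i)
    (hne : ∀ i, threshold M i v ≠ v i) (i : Fin n) :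
    lazyWins M W v p i ↔ M.Indep {i} ∧ max (threshold M i v) (p i) ≤ v i := by
  have hv0 : ∀ i, 0 ≤ v i := fun i => (hv i).le
  constructor
  · rintro ⟨h1, h2⟩
    rw [lazyPrice, hW.vcgPayment_eq hv0 h1] at h2
    exact ⟨hW.indep_singleton hv0 h1, h2⟩
  · rintro ⟨h1, h2⟩
    have hmem := (hW.mem_iff hv hne i).2 ⟨h1, (le_max_left _ _).trans h2⟩
    refine ⟨hmem, ?_⟩
    rwa [lazyPrice, hW.vcgPayment_eq hv0 hmem]

variable {P : Fin n → Measure ℝ} [∀ i, IsProbabilityMeasure (P i)]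

open Classical in
-- Common form of revenue and welfare: `g x y` is what an accepted price `x` yields from a bidder of
-- value `y`, and `J i x` is its expectation over acceptance.
lemma integral_sum_lazyWins (hW : IsVCGRule M W) (hf : ∀ i, IsSingleCrossing (F i) (f i))
    (a : (Fin n → ℝ) × (Fin n → ℝ) → Fin n → ℝ) {g : ℝ → ℝ → ℝ}
    (hg : Measurable (Function.uncurry g)) (hb : ∀ t y, 0 ≤ t → t ≤ y → |g t y| ≤ |y|)
    {J : Fin n → ℝ → ℝ} (hJm : ∀ i, Measurable (J i)) {C : Fin n → ℝ}
    (hJC : ∀ i x, 0 ≤ x → |J i x| ≤ C i) (hJ : ∀ i x, ∫ y in Set.Ioi x, g x y ∂F i = J i x)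
    (ha : ∀ q i, (∀ i, 0 ≤ q.1 i) → i ∈ W q.1 →
      a q i = g (max (threshold M i q.1) (q.2 i)) (q.1 i)) :
    ∫ q, ∑ i, (if lazyWins M W q.1 q.2 i then a q i else 0)
        ∂(Measure.pi F).prod (Measure.pi P)
      = ∑ i ∈ nonloops M, ∫ v, (∫ p, J i (max (threshold M i v) p) ∂P i) ∂Measure.pi F := by
  have key := fun i => integral_offer_indicator (P := P) i (measurable_threshold M i)
    (threshold_update M i) (threshold_nonneg M i) (hf i).integrable hg hb (hJm i) (hJC i)
    (fun x => (setIntegral_Ici_eq hf i x _).trans (hJ i x))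
  rw [← Finset.sum_congr rfl fun i _ => (key i).2.2, ← integral_finsetSum _ fun i _ => (key i).1]
  refine integral_congr_ae ?_
  have hae : ∀ᵐ q ∂(Measure.pi F).prod (Measure.pi P),
      (∀ i, 0 < q.1 i) ∧ ∀ i, threshold M i q.1 ≠ q.1 i :=
    Measure.quasiMeasurePreserving_fst.ae (ae_pos_and_threshold_ne hf)
  filter_upwards [hae] with q hq
  rw [nonloops, Finset.sum_filter]
  refine Finset.sum_congr rfl fun i _ => ?_
  by_cases hi : M.Indep {i}
  · rw [if_pos hi]
    by_cases hw : lazyWins M W q.1 q.2 i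
    · rw [if_pos hw, ha q i (fun i => (hq.1 i).le) hw.1,
        Set.indicator_of_mem (by exact ((lazyWins_iff hW hq.1 hq.2 i).1 hw).2)]
    · rw [if_neg hw, Set.indicator_of_notMem]
      exact fun h => hw ((lazyWins_iff hW hq.1 hq.2 i).2 ⟨hi, h⟩)
  · rw [if_neg hi, if_neg]
    exact fun hw => hi ((lazyWins_iff hW hq.1 hq.2 i).1 hw).1

lemma lazyRevenue_eq (hW : IsVCGRule M W) (hf : ∀ i, IsSingleCrossing (F i) (f i)) :
    lazyRevenue M W F P = ∑ i ∈ nonloops M,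
      ∫ v, (∫ p, priceRevenue (F i) (max (threshold M i v) p) ∂P i) ∂Measure.pi F := by
  refine integral_sum_lazyWins hW hf (fun q i => lazyPrice M W q.1 q.2 i) (g := fun x _ => x)
    measurable_fst (fun t y ht hty => ?_) (fun i => measurable_priceRevenue (F i))
    (C := fun i => ∫ y, y ∂F i) (fun i x hx => ?_) (fun i x => ?_) fun q i hq hi => ?_
  · rw [abs_of_nonneg ht, abs_of_nonneg (ht.trans hty)]
    exact hty
  · rw [abs_of_nonneg (priceRevenue_nonneg _ hx)]
    exact (hf i).priceRevenue_le_mean x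
  · simp [priceRevenue, mul_comm]
  · rw [lazyPrice, hW.vcgPayment_eq hq hi]

lemma lazyWelfare_eq (hW : IsVCGRule M W) (hf : ∀ i, IsSingleCrossing (F i) (f i)) :
    lazyWelfare M W F P = ∑ i ∈ nonloops M,
      ∫ v, (∫ p, (∫ y in Set.Ioi (max (threshold M i v) p), y ∂F i) ∂P i) ∂Measure.pi F := by
  refine integral_sum_lazyWins hW hf (fun q i => q.1 i) (g := fun _ y => y)
    measurable_snd (fun t y _ _ => le_rfl) (fun i => measurable_setIntegral_Ioi (hf i))
    (C := fun i => ∫ y, y ∂F i) (fun i x _ => ?_) (fun i x => rfl) fun q i _ _ => rfl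
  rw [abs_of_nonneg ((hf i).setIntegral_nonneg x)]
  exact (hf i).setIntegral_le_integral x

lemma integrable_pricing (hf : ∀ i, IsSingleCrossing (F i) (f i)) (i : Fin n) :
    Integrable (fun v => ∫ p, priceRevenue (F i) (max (threshold M i v) p) ∂P i)
      (Measure.pi F) := by
  refine (integral_offer_indicator (P := P) i (measurable_threshold M i)
    (threshold_update M i) (threshold_nonneg M i) (hf i).integrable (g := fun x _ => x)
    measurable_fst (fun t y ht hty => ?_) (measurable_priceRevenue (F i))
    (C := ∫ y, y ∂F i) (fun x hx => ?_) (fun x => ?_)).2.1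
  · rw [abs_of_nonneg ht, abs_of_nonneg (ht.trans hty)]
    exact hty
  · rw [abs_of_nonneg (priceRevenue_nonneg _ hx)]
    exact (hf i).priceRevenue_le_mean x
  · rw [setIntegral_Ici_eq hf]
    simp [priceRevenue, mul_comm]

lemma integrable_serving (hf : ∀ i, IsSingleCrossing (F i) (f i)) (i : Fin n) :
    Integrable (fun v => ∫ p, (∫ y in Set.Ioi (max (threshold M i v) p), y ∂F i) ∂P i)
      (Measure.pi F) := by
  refine (integral_offer_indicator (P := P) i (measurable_threshold M i)
    (threshold_update M i) (threshold_nonneg M i) (hf i).integrable (g := fun _ y => y)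
    measurable_snd (fun t y _ _ => le_rfl) (measurable_setIntegral_Ioi (hf i))
    (C := ∫ y, y ∂F i) (fun x hx => ?_) (fun x => setIntegral_Ici_eq hf i x _)).2.1
  rw [abs_of_nonneg ((hf i).setIntegral_nonneg x)]
  exact (hf i).setIntegral_le_integral x

/-- The expected revenue of a truthful mechanism is at most its expected virtual surplus. -/
lemma Mechanism.IsTruthful.integral_pay_le {A : Mechanism n} (hA : A.IsTruthful M F)
    (hf : ∀ i, IsSingleCrossing (F i) (f i)) (i : Fin n) :
    Integrable (fun v => virtualValue (F i) (f i) (v i) * A.alloc v i) (Measure.pi F) ∧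
    ∫ v, A.pay v i ∂Measure.pi F
      ≤ ∫ v, virtualValue (F i) (f i) (v i) * A.alloc v i ∂Measure.pi F := by
  have hae : ∀ᵐ v ∂Measure.pi F, ∀ i, 0 ≤ v i :=
    ae_pi_of_ae (p := fun _ y => 0 ≤ y) fun i => (hf i).ae_nonneg
  have hmeas : Measurable fun v => A.alloc v i :=
    (measurable_pi_apply i).comp hA.measurable_alloc
  have hmem : ∀ v, (∀ j, 0 ≤ v j) → A.alloc v i ∈ Set.Icc (0 : ℝ) 1 := fun v hv =>
    ⟨(mem_Icc_of_mem_feasible (hA.feasible v hv)).1 i,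
      (mem_Icc_of_mem_feasible (hA.feasible v hv)).2 i⟩
  have hnorm : ∀ v, (∀ j, 0 ≤ v j) → ‖A.alloc v i‖ ≤ 1 := fun v hv => by
    rw [Real.norm_of_nonneg (hmem v hv).1]
    exact (hmem v hv).2
  have hint : Integrable (fun v => virtualValue (F i) (f i) (v i) * A.alloc v i)
      (Measure.pi F) :=
    (integrable_comp_eval i (hf i).integrable_virtualValue).mul_bdd (c := 1)
      hmeas.aestronglyMeasurable (hae.mono hnorm)
  refine ⟨hint, ?_⟩
  have hupd : ∀ v : Fin n → ℝ, (∀ j, 0 ≤ v j) → ∀ b, 0 ≤ b →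
      ∀ j, 0 ≤ Function.update v i b j := fun v hv b hb j => by
    by_cases hj : j = i
    · subst hj; simpa
    · simpa [Function.update_of_ne hj] using hv j
  set X : ℝ → ℝ := fun b => ∫ v, A.alloc (Function.update v i b) i ∂Measure.pi F
  set Q : ℝ → ℝ := fun b => ∫ v, A.pay (Function.update v i b) i ∂Measure.pi F
  have hallocI : ∀ b, 0 ≤ b →
      Integrable (fun v => A.alloc (Function.update v i b) i) (Measure.pi F) := fun b hb => by
    have hm : Measurable fun v : Fin n → ℝ => Function.update v i b :=
      (measurable_update_prod i).comp (measurable_id.prodMk measurable_const)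
    exact Integrable.of_bound (hmeas.comp hm).aestronglyMeasurable 1
      (hae.mono fun v hv => hnorm _ (hupd v hv b hb))
  have hutil : ∀ t b, 0 ≤ b → A.utility F i t b = t * X b - Q b := fun t b hb => by
    rw [Mechanism.utility, integral_sub ((hallocI b hb).const_mul t) (hA.integrable_interim i b hb),
      integral_const_mul]
  have hX : ∀ b, 0 ≤ b → X b ∈ Set.Icc (0 : ℝ) 1 := fun b hb => by
    constructor
    · exact integral_nonneg_of_ae (hae.mono fun v hv => (hmem _ (hupd v hv b hb)).1)
    · have := integral_mono_ae (hallocI b hb) (integrable_const (1 : ℝ))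
        (hae.mono fun v hv => (hmem _ (hupd v hv b hb)).2)
      simpa using this
  have hQ : Integrable Q (F i) := (integrable_update F i (hA.integrable_pay i)).integral_prod_right
  have h := integral_pay_le_virtual (hf i) hX hQ
    (fun t ht b hb => by
      rw [← hutil t b hb, ← hutil t t ht]
      exact hA.incentive_compatible i t ht b hb)
    (fun t ht => by
      rw [← hutil t t ht]
      exact hA.individually_rational i t ht)
  rw [integral_update' F i (hA.integrable_pay i), integral_update' F i hint]
  refine h.trans (le_of_eq ?_)
  simp only [Function.update_self, integral_const_mul, X]

/-- Virtual values never exceed values, so the pointwise bound `sum_virtual_le` applies; its right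
side then splits into threshold integrals, one per bidder. -/
lemma Mechanism.IsTruthful.revenue_le {A : Mechanism n} (hA : A.IsTruthful M F)
    (hf : ∀ i, IsSingleCrossing (F i) (f i)) (hW : IsVCGRule M W) :
    A.revenue F ≤ ∑ i ∈ nonloops M, ∫ v, (∫ y in Set.Ioi (threshold M i v),
      (max (virtualValue (F i) (f i) y) 0 + threshold M i v) ∂F i) ∂Measure.pi F := by
  have hI := fun i => (hA.integral_pay_le hf i).1
  have key := fun i => integral_threshold_indicator i (measurable_threshold M i)
    (threshold_update M i) (threshold_nonneg M i)
    (c := fun y => |max (virtualValue (F i) (f i) y) 0| + |y|)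
    ((hf i).integrable_virtualValue.pos_part.abs.add (hf i).integrable.abs)
    (fun y => by positivity)
    (g := fun t y => max (virtualValue (F i) (f i) y) 0 + t)
    ((((hf i).measurable_virtualValue.comp measurable_snd).max measurable_const).add
      measurable_fst)
    (fun t y ht hty => by
      refine (abs_add_le _ _).trans ?_
      rw [abs_of_nonneg ht, abs_of_nonneg (ht.trans hty)]
      gcongr)
  rw [Mechanism.revenue, integral_finsetSum _ fun i _ => hA.integrable_pay i]
  refine (Finset.sum_le_sum fun i _ => (hA.integral_pay_le hf i).2).trans ?_
  simp_rw [← setIntegral_Ici_eq hf]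
  rw [← integral_finsetSum _ fun i _ => hI i,
    ← Finset.sum_congr rfl fun i _ => (key i).2.2, ← integral_finsetSum _ fun i _ => (key i).1]
  refine integral_mono_ae (integrable_finsetSum _ fun i _ => hI i)
    (integrable_finsetSum _ fun i _ => (key i).1) ?_
  filter_upwards [ae_pos_and_threshold_ne (M := M) hf] with v hv
  refine (hW.sum_virtual_le hv.1 (hA.feasible v fun i => (hv.1 i).le)
    fun i => (hf i).virtualValue_le (v i)).trans (le_of_eq ?_)
  exact hW.sum_eq hv.1 hv.2 fun i v => max (virtualValue (F i) (f i) (v i)) 0 + threshold M i v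

lemma Mechanism.IsTruthful.welfare_le {A : Mechanism n} (hA : A.IsTruthful M F)
    (hf : ∀ i, IsSingleCrossing (F i) (f i)) (hW : IsVCGRule M W) :
    A.welfare F ≤ ∑ i ∈ nonloops M,
      ∫ v, (∫ y in Set.Ioi (threshold M i v), y ∂F i) ∂Measure.pi F := by
  have key := fun i => integral_threshold_indicator i (measurable_threshold M i)
    (threshold_update M i) (threshold_nonneg M i) (hf i).integrable.abs (fun y => abs_nonneg y)
    (g := fun _ y => y) measurable_snd (fun t y _ _ => le_rfl)
  simp_rw [← setIntegral_Ici_eq hf]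
  rw [← Finset.sum_congr rfl fun i _ => (key i).2.2, ← integral_finsetSum _ fun i _ => (key i).1,
    Mechanism.welfare]
  -- Nonnegativity of the welfare replaces its integrability, so only the VCG side must be
  -- integrable.
  refine integral_mono_of_nonneg ?_ (integrable_finsetSum _ fun i _ => (key i).1) ?_
  · filter_upwards [ae_pos_and_threshold_ne (M := M) hf] with v hv
    have hx := (mem_Icc_of_mem_feasible (hA.feasible v fun i => (hv.1 i).le)).1
    exact Finset.sum_nonneg fun i _ => mul_nonneg (hx i) (hv.1 i).le
  · filter_upwards [ae_pos_and_threshold_ne (M := M) hf] with v hv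
    have h1 := sum_mul_le_of_mem_feasible (hA.feasible v fun i => (hv.1 i).le)
      (hW v fun i => (hv.1 i).le).2
    simp_rw [mul_comm (A.alloc v _)]
    exact h1.trans (hW.sum_eq hv.1 hv.2 fun i v => v i).le

end Main

end LazyVCG

end

theorem mainTheorem7 (n : ℕ) (M : Matroid (Fin n)) (hM : M.E = Set.univ)
    (F : Fin n → Measure ℝ) [∀ i, IsProbabilityMeasure (F i)]
    (μ σ : Fin n → ℝ) (hμ : ∀ i, 0 < μ i) (hσ : ∀ i, 0 ≤ σ i)
    (hF : ∀ i, LazyVCG.IsMeanStd (F i) (μ i) (σ i)) (hreg : ∀ i, LazyVCG.IsRegular (F i))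
    (W : (Fin n → ℝ) → Finset (Fin n)) (hW : LazyVCG.IsVCGRule M W) :
    LazyVCG.optRevenue M F ≤
        ((2 * LazyVCG.rho (⨆ i, σ i / μ i) *
          LazyVCG.lazyRevenue M W F (fun i => LazyVCG.logLottery (μ i) (σ i)) : ℝ) : EReal) ∧
      LazyVCG.optWelfare M F ≤
        ((LazyVCG.rho (⨆ i, σ i / μ i) *
          LazyVCG.lazyWelfare M W F (fun i => LazyVCG.logLottery (μ i) (σ i)) : ℝ) : EReal) := by
  have hcross : ∀ i, ∃ f, LazyVCG.IsSingleCrossing (F i) f := fun i =>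
    (hreg i).exists_isSingleCrossing (hF i).nonneg ((hF i).memLp.integrable (by norm_num))
  choose f hf using hcross
  -- Monotonicity of `rho` replaces the individual ratios by their maximum, after which the
  -- comparison is made bidder by bidder and threshold by threshold.
  have hρ : ∀ i, LazyVCG.rho (σ i / μ i) ≤ LazyVCG.rho (⨆ i, σ i / μ i) := fun i =>
    LazyVCG.rho_le_rho (div_nonneg (hσ i) (hμ i).le)
      (le_ciSup (f := fun i => σ i / μ i) (Set.finite_range _).bddAbove i)
  constructor
  · refine iSup₂_le fun A hA => EReal.coe_le_coe_iff.2 ?_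
    refine (hA.revenue_le hf hW).trans ?_
    rw [LazyVCG.lazyRevenue_eq hW hf, Finset.mul_sum]
    refine Finset.sum_le_sum fun i _ => ?_
    rw [← integral_const_mul]
    refine integral_mono_of_nonneg (Filter.Eventually.of_forall fun v => ?_)
      ((LazyVCG.integrable_pricing (M := M)
        (P := fun i => LazyVCG.logLottery (μ i) (σ i)) hf i).const_mul _) (Filter.Eventually.of_forall fun v => ?_)
    · exact integral_nonneg fun y =>
        add_nonneg (le_max_right _ _) (LazyVCG.threshold_nonneg M i v)
    · refine (LazyVCG.virtual_surplus_le_rho_mul (hf i) (hμ i) (hF i)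
        (LazyVCG.threshold_nonneg M i v)).trans ?_
      refine mul_le_mul_of_nonneg_right (by linarith [hρ i]) (integral_nonneg fun p => ?_)
      exact LazyVCG.priceRevenue_nonneg _
        ((LazyVCG.threshold_nonneg M i v).trans (le_max_left _ _))
  · refine iSup₂_le fun A hA => EReal.coe_le_coe_iff.2 ?_
    refine (hA.welfare_le hf hW).trans ?_
    rw [LazyVCG.lazyWelfare_eq hW hf, Finset.mul_sum]
    refine Finset.sum_le_sum fun i _ => ?_
    rw [← integral_const_mul]
    refine integral_mono_of_nonneg (Filter.Eventually.of_forall fun v => ?_)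
      ((LazyVCG.integrable_serving (M := M)
        (P := fun i => LazyVCG.logLottery (μ i) (σ i)) hf i).const_mul _) (Filter.Eventually.of_forall fun v => ?_)
    · exact (hf i).setIntegral_nonneg _
    · refine (LazyVCG.setIntegral_le_rho_mul (hf i) (hμ i) (hF i) _).trans ?_
      exact mul_le_mul_of_nonneg_right (hρ i) (integral_nonneg fun p =>
        (hf i).setIntegral_nonneg _)
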